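/- Rings are associative with unit and modules are left modules. Let $R$ be a ring and let $\Sigma$ be a set of endomorphisms of finitely generated projective $R$-modules. A ring homomorphism $f\colon R\to T$ is called $\Sigma$-inverting if $\mathrm{id}_T\otimes_R\sigma$ is bijective for every $\sigma\in\Sigma$. Let $i\colon R\to R_\Sigma$ be the universal $\Sigma$-inverting ring homomorphism: $i$ is $\Sigma$-inverting, and for every $\Sigma$-inverting ring homomorphism $f\colon R\to T$ there is exactly one ring homomorphism $g\colon R_\Sigma\to T$ with $g\circ i=f$. Let $K_1(R,\Sigma)$ be the abelian group with one generator $[f]$ for each endomorphism $f\colon P\to P$ of a finitely generated projective $R$-module $P$ such that $\mathrm{id}_{R_\Sigma}\otimes_R f$ is bijective, and with the following relations. * $[g\circ f]=[g]+[f]$ whenever $f,g\colon P\to P$ are endomorphisms of the same finitely generated projective $R$-module $P$ that become bijective over $R_\Sigma$. * $[f_1]=[f_0]+[f_2]$ whenever $0\to P_0\xrightarrow{j}P_1\xrightarrow{q}P_2\to 0$ is a short exact sequence of finitely generated projective $R$-modules and $f_k\colon P_k\to P_k$ $(k=0,1,2)$ are endomorphisms with $f_1\circ j=j\circ f_0$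 and $f_2\circ q=q\circ f_1$ such that $f_0$ and $f_2$ (and hence $f_1$) become bijective over $R_\Sigma$. For a ring $S$, let $K_1(S)$ be the abelian group defined in the same way, with the automorphisms of finitely generated projective $S$-modules as generators. Theorem. Suppose that $i\colon R\to R_\Sigma$ is injective. Then the homomorphism $$\alpha\colon K_1(R,\Sigma)\to K_1(R_\Sigma),\qquad [f\colon P\to P]\mapsto[\mathrm{id}_{R_\Sigma}\otimes_R f\colon R_\Sigma\otimes_R P\to R_\Sigma\otimes_R P]$$ is bijective. -/

import Mathlib

open scoped TensorProduct

universe u v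

noncomputable section

/-! ### Extension of scalars along a ring homomorphism of noncommutative rings -/

section BaseChange

variable {R : Type u} {S : Type u} [Ring R] [Ring S]

/-- The `S`-submodule of `S ⊗[ℤ] P` generated by the elements `s i(r) ⊗ p - s ⊗ r p`. -/
def balancedRel (i : R →+* S) (P : Type u) [AddCommGroup P] [Module R P] :
    Submodule S (S ⊗[ℤ] P) :=
  Submodule.span S {x | ∃ (s : S) (r : R) (p : P),
    x = (s * i r) ⊗ₜ[ℤ] p - s ⊗ₜ[ℤ] (r • p)}

/-- The left `S`-module `S ⊗_R P` for a ring homomorphism `i : R → S` and a left `R`-module `P`.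
The rings need not be commutative: `S ⊗_R P` is the quotient of `S ⊗_ℤ P` by the relations
`s i(r) ⊗ p = s ⊗ r p`. -/
def BaseChange (i : R →+* S) (P : Type u) [AddCommGroup P] [Module R P] : Type u :=
  (S ⊗[ℤ] P) ⧸ balancedRel i P

namespace BaseChange

variable (i : R →+* S)
variable {P : Type u} [AddCommGroup P] [Module R P]
variable {Q : Type u} [AddCommGroup Q] [Module R Q]
variable {N : Type u} [AddCommGroup N] [Module R N]

instance : AddCommGroup (BaseChange i P) :=
  inferInstanceAs (AddCommGroup ((S ⊗[ℤ] P) ⧸ balancedRel i P))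

instance : Module S (BaseChange i P) :=
  inferInstanceAs (Module S ((S ⊗[ℤ] P) ⧸ balancedRel i P))

/-- The element `s ⊗ p` of `S ⊗_R P`. -/
def tmul (s : S) (p : P) : BaseChange i P :=
  (balancedRel i P).mkQ (s ⊗ₜ[ℤ] p)

theorem tmul_add (s : S) (p q : P) : tmul i s (p + q) = tmul i s p + tmul i s q := by
  simp only [tmul, TensorProduct.tmul_add, map_add]
  rfl

theorem add_tmul (s t : S) (p : P) : tmul i (s + t) p = tmul i s p + tmul i t p := by
  simp only [tmul, TensorProduct.add_tmul, map_add]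
  rfl

theorem smul_tmul (s t : S) (p : P) : s • tmul i t p = tmul i (s * t) p := by
  change s • (balancedRel i P).mkQ (t ⊗ₜ[ℤ] p) = (balancedRel i P).mkQ ((s * t) ⊗ₜ[ℤ] p)
  rw [← map_smul, TensorProduct.smul_tmul', smul_eq_mul]

theorem tmul_smul (s : S) (r : R) (p : P) : tmul i s (r • p) = tmul i (s * i r) p := by
  symm
  rw [tmul, tmul]
  exact (Submodule.Quotient.eq _).2 (Submodule.subset_span ⟨s, r, p, rfl⟩)

theorem tmul_zero (s : S) : tmul i s (0 : P) = 0 := by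
  simp only [tmul, TensorProduct.tmul_zero, LinearMap.map_zero]
  rfl

theorem induction_on {motive : BaseChange i P → Prop} (x : BaseChange i P)
    (zero : motive 0) (tmul : ∀ s p, motive (tmul i s p))
    (add : ∀ x y, motive x → motive y → motive (x + y)) : motive x := by
  obtain ⟨y, rfl⟩ := (balancedRel i P).mkQ_surjective x
  induction y using TensorProduct.induction_on with
  | zero => exact zero
  | tmul s p => exact tmul s p
  | add a b ha hb => exact add _ _ ha hb

theorem hom_ext {M : Type v} [AddCommGroup M] [Module S M] {f g : BaseChange i P →ₗ[S] M}
    (h : ∀ p, f (tmul i 1 p) = g (tmul i 1 p)) : f = g := by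
  ext x
  induction x using induction_on with
  | zero => simp
  | tmul s p =>
    have := smul_tmul i s 1 p
    rw [mul_one] at this
    rw [← this, map_smul, map_smul, h]
  | add x y hx hy => rw [map_add, map_add, hx, hy]

/-- An additive map `φ : P → M` into an `S`-module with `φ (r p) = i(r) φ(p)` induces the
`S`-linear map `S ⊗_R P → M`, `s ⊗ p ↦ s φ(p)`. -/
def lift {M : Type v} [AddCommGroup M] [Module S M] (φ : P →+ M)
    (h : ∀ (r : R) (p : P), φ (r • p) = i r • φ p) : BaseChange i P →ₗ[S] M :=
  (balancedRel i P).liftQ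
    (TensorProduct.AlgebraTensorModule.lift
      ((LinearMap.toSpanSingleton S (P →ₗ[ℤ] M) φ.toIntLinearMap)))
    (by
      rw [balancedRel, Submodule.span_le]
      rintro _ ⟨s, r, p, rfl⟩
      simp [h, mul_smul])

theorem lift_tmul {M : Type v} [AddCommGroup M] [Module S M] (φ : P →+ M)
    (h : ∀ (r : R) (p : P), φ (r • p) = i r • φ p) (s : S) (p : P) :
    lift i φ h (tmul i s p) = s • φ p := by
  change (balancedRel i P).liftQ _ _ ((balancedRel i P).mkQ (s ⊗ₜ[ℤ] p)) = _
  simp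

/-- The induced map `id_S ⊗_R f : S ⊗_R P → S ⊗_R Q`, `s ⊗ p ↦ s ⊗ f(p)`. -/
def map (f : P →ₗ[R] Q) : BaseChange i P →ₗ[S] BaseChange i Q :=
  lift i (AddMonoidHom.mk' (fun p => tmul i 1 (f p)) (fun p q => by rw [map_add, tmul_add]))
    (fun r p => by
      change tmul i 1 (f (r • p)) = i r • tmul i 1 (f p)
      rw [map_smul, tmul_smul, smul_tmul, one_mul, mul_one])

theorem map_tmul (f : P →ₗ[R] Q) (s : S) (p : P) : map i f (tmul i s p) = tmul i s (f p) := by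
  rw [map, lift_tmul]
  change s • tmul i 1 (f p) = _
  rw [smul_tmul, mul_one]

theorem map_id : map i (LinearMap.id : P →ₗ[R] P) = LinearMap.id :=
  hom_ext i fun p => by rw [map_tmul]; rfl

theorem map_comp (g : Q →ₗ[R] N) (f : P →ₗ[R] Q) : map i (g ∘ₗ f) = map i g ∘ₗ map i f :=
  hom_ext i fun p => by simp [map_tmul]

theorem map_zero : map i (0 : P →ₗ[R] Q) = 0 :=
  hom_ext i fun p => by
    rw [map_tmul, LinearMap.zero_apply, LinearMap.zero_apply, tmul_zero]

theorem map_add (f g : P →ₗ[R] Q) : map i (f + g) = map i f + map i g :=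
  hom_ext i fun p => by
    rw [LinearMap.add_apply, map_tmul, map_tmul, map_tmul, LinearMap.add_apply, tmul_add]

instance [Module.Finite R P] : Module.Finite S (BaseChange i P) := by
  obtain ⟨t, ht⟩ := (Module.finite_def.1 ‹Module.Finite R P›)
  classical
  refine ⟨⟨t.image (tmul i 1), ?_⟩⟩
  rw [eq_top_iff]
  have key : ∀ p : P, tmul i 1 p ∈ Submodule.span S ((t.image (tmul i 1) : Finset _) : Set _) := by
    intro p
    have hp : p ∈ Submodule.span R (t : Set P) := ht ▸ Submodule.mem_top
    induction hp using Submodule.span_induction with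
    | mem x hx => exact Submodule.subset_span (by simpa using ⟨x, hx, rfl⟩)
    | zero => rw [tmul_zero]; exact Submodule.zero_mem _
    | add x y _ _ hx hy => rw [tmul_add]; exact Submodule.add_mem _ hx hy
    | smul r x _ hx =>
      rw [tmul_smul, one_mul, ← mul_one (i r), ← smul_tmul]
      exact Submodule.smul_mem _ _ hx
  intro x _
  induction x using induction_on with
  | zero => exact Submodule.zero_mem _
  | tmul s p =>
    rw [← mul_one s, ← smul_tmul]
    exact Submodule.smul_mem _ _ (key p)
  | add x y hx hy => exact Submodule.add_mem _ (hx trivial) (hy trivial)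

instance [Module.Projective R P] : Module.Projective S (BaseChange i P) := by
  refine Module.Projective.of_lifting_property (fun {M N} _ _ _ _ f g hf => ?_)
  let _ : Module R M := Module.compHom M i
  let _ : Module R N := Module.compHom N i
  let f' : M →ₗ[R] N := { f.toAddMonoidHom with map_smul' := fun r m => f.map_smul (i r) m }
  let g' : P →ₗ[R] N :=
    { toFun := fun p => g (tmul i 1 p)
      map_add' := fun p q => by rw [tmul_add, _root_.map_add]
      map_smul' := fun r p => by
        change _ = i r • g (tmul i 1 p)
        rw [← _root_.map_smul, smul_tmul, tmul_smul, one_mul, mul_one] }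
  obtain ⟨h, hh⟩ := Module.projective_lifting_property f' g' hf
  refine ⟨lift i h.toAddMonoidHom (fun r p => h.map_smul r p), hom_ext i fun p => ?_⟩
  refine (congrArg f ((lift_tmul i h.toAddMonoidHom _ 1 p).trans (one_smul S _))).trans ?_
  exact LinearMap.congr_fun hh p

/-- A short exact sequence with projective quotient stays short exact after extension of scalars. -/
theorem map_exact [Module.Projective R N] {f : P →ₗ[R] Q} {g : Q →ₗ[R] N}
    (hf : Function.Injective f) (hfg : Function.Exact f g) (hg : Function.Surjective g) :
    Function.Injective (map i f) ∧ Function.Exact (map i f) (map i g) ∧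
      Function.Surjective (map i g) := by
  obtain ⟨t, ht⟩ := Module.projective_lifting_property g LinearMap.id hg
  have hr : ∀ q, ∃ p, f p = q - t (g q) := fun q => (hfg _).1 (by
    have := LinearMap.congr_fun ht (g q)
    simp only [LinearMap.comp_apply, LinearMap.id_apply] at this
    rw [map_sub, this, sub_self])
  choose r hr using hr
  let r' : Q →ₗ[R] P :=
    { toFun := r
      map_add' := fun x y => hf (by rw [_root_.map_add, hr, hr, hr]; simp; abel)
      map_smul' := fun c x => hf (by simp [hr, smul_sub]) }
  have h1 : r' ∘ₗ f = LinearMap.id := LinearMap.ext fun p => hf (by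
    change f (r (f p)) = f p
    rw [hr, (hfg (f p)).2 ⟨p, rfl⟩, _root_.map_zero, sub_zero])
  have h2 : f ∘ₗ r' + t ∘ₗ g = LinearMap.id := LinearMap.ext fun q => by
    change f (r q) + t (g q) = q
    rw [hr, sub_add_cancel]
  have h3 : g ∘ₗ f = 0 := LinearMap.ext fun p => (hfg (f p)).2 ⟨p, rfl⟩
  have k1 : ∀ x, map i r' (map i f x) = x := fun x => by
    rw [← LinearMap.comp_apply, ← map_comp, h1, map_id, LinearMap.id_apply]
  have k2 : ∀ x, map i f (map i r' x) + map i t (map i g x) = x := fun x => by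
    rw [← LinearMap.comp_apply, ← map_comp, ← LinearMap.comp_apply, ← map_comp,
      ← LinearMap.add_apply, ← map_add, h2, map_id, LinearMap.id_apply]
  have k3 : ∀ x, map i g (map i f x) = 0 := fun x => by
    rw [← LinearMap.comp_apply, ← map_comp, h3, map_zero, LinearMap.zero_apply]
  have k4 : ∀ x, map i g (map i t x) = x := fun x => by
    rw [← LinearMap.comp_apply, ← map_comp, ht, map_id, LinearMap.id_apply]
  refine ⟨fun x y h => by rw [← k1 x, h, k1], fun y => ⟨fun h => ⟨map i r' y, ?_⟩, ?_⟩,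
    fun x => ⟨_, k4 x⟩⟩
  · have := k2 y
    rwa [h, _root_.map_zero, add_zero] at this
  · rintro ⟨x, rfl⟩
    exact k3 x

end BaseChange

end BaseChange

/-! ### Endomorphisms of finitely generated projective modules -/

/-- An endomorphism `hom : P → P` of a finitely generated projective left `R`-module `P`. -/
structure FGProjEnd (R : Type u) [Ring R] where
  /-- the underlying module -/
  P : Type u
  [addCommGroup : AddCommGroup P]
  [module : Module R P]
  [finite : Module.Finite R P]
  [projective : Module.Projective R P]
  /-- the endomorphism -/
  hom : P →ₗ[R] P

attribute [instance] FGProjEnd.addCommGroup FGProjEnd.module FGProjEnd.finite FGProjEnd.projective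

namespace FGProjEnd

variable {R : Type u} [Ring R] {S : Type u} [Ring S]

/-- The endomorphism `id_S ⊗_R f` of the finitely generated projective `S`-module `S ⊗_R P`. -/
def baseChange (i : R →+* S) (x : FGProjEnd R) : FGProjEnd S where
  P := BaseChange i x.P
  hom := BaseChange.map i x.hom

/-- The endomorphism is an automorphism. -/
def IsAuto (x : FGProjEnd R) : Prop := Function.Bijective x.hom

/-- The endomorphism becomes an automorphism after extension of scalars along `i`. -/
def BecomesAuto (i : R →+* S) (x : FGProjEnd R) : Prop := (x.baseChange i).IsAuto

/-- `x₀`, `x₁`, `x₂` are the vertical maps of a commutative diagram with exact rows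
`0 → P₀ → P₁ → P₂ → 0`, the upper and the lower row being the same short exact sequence. -/
def ShortExact (x₀ x₁ x₂ : FGProjEnd R) : Prop :=
  ∃ (j : x₀.P →ₗ[R] x₁.P) (q : x₁.P →ₗ[R] x₂.P),
    Function.Injective j ∧ Function.Exact j q ∧ Function.Surjective q ∧
    x₁.hom ∘ₗ j = j ∘ₗ x₀.hom ∧ x₂.hom ∘ₗ q = q ∘ₗ x₁.hom

theorem ShortExact.baseChange (i : R →+* S) {x₀ x₁ x₂ : FGProjEnd R} (h : ShortExact x₀ x₁ x₂) :
    ShortExact (x₀.baseChange i) (x₁.baseChange i) (x₂.baseChange i) := by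
  obtain ⟨j, q, hj, hjq, hq, h1, h2⟩ := h
  obtain ⟨k1, k2, k3⟩ := BaseChange.map_exact i hj hjq hq
  refine ⟨BaseChange.map i j, BaseChange.map i q, k1, k2, k3, ?_, ?_⟩
  · change BaseChange.map i x₁.hom ∘ₗ BaseChange.map i j =
      BaseChange.map i j ∘ₗ BaseChange.map i x₀.hom
    rw [← BaseChange.map_comp, h1, BaseChange.map_comp]
  · change BaseChange.map i x₂.hom ∘ₗ BaseChange.map i q =
      BaseChange.map i q ∘ₗ BaseChange.map i x₁.hom
    rw [← BaseChange.map_comp, h2, BaseChange.map_comp]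

end FGProjEnd

/-! ### Universal localization -/

/-- A ring homomorphism `f : R → T` is `Sig`-inverting if `id_T ⊗_R σ` is bijective for every
element `σ` of `Sig`. -/
def IsInverting {R : Type u} [Ring R] (Sig : Set (FGProjEnd R)) {T : Type u} [Ring T]
    (f : R →+* T) : Prop :=
  ∀ σ ∈ Sig, σ.BecomesAuto f

/-- `i : R → S` is a universal `Sig`-inverting ring homomorphism, that is, `S` is the universal
localization `R_Sig` and `i` is the canonical map. -/
structure IsUniversalLocalization {R : Type u} [Ring R] (Sig : Set (FGProjEnd R)) {S : Type u}
    [Ring S] (i : R →+* S) : Prop where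
  inverting : IsInverting Sig i
  existsUnique_lift : ∀ (T : Type u) [Ring T] (f : R →+* T), IsInverting Sig f →
    ∃! g : S →+* T, g.comp i = f

/-! ### The groups `K₁` -/

section K1

variable {R : Type u} [Ring R] {S : Type u} [Ring S]

/-- The defining relations, for generators `[x]` where `x` runs through the endomorphisms of
finitely generated projective modules satisfying `W`: `[g ∘ f] = [g] + [f]` for endomorphisms of
the same module, and `[f₁] = [f₀] + [f₂]` for endomorphisms of a short exact sequence. -/
inductive K1Rel (W : FGProjEnd R → Prop) : FreeAbelianGroup {x : FGProjEnd R // W x} → Prop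
  | comp (P : Type u) [AddCommGroup P] [Module R P] [Module.Finite R P] [Module.Projective R P]
      (g f : P →ₗ[R] P) (hg : W ⟨P, g⟩) (hf : W ⟨P, f⟩) (hgf : W ⟨P, g ∘ₗ f⟩) :
      K1Rel W (FreeAbelianGroup.of ⟨⟨P, g ∘ₗ f⟩, hgf⟩ -
        (FreeAbelianGroup.of ⟨⟨P, g⟩, hg⟩ + FreeAbelianGroup.of ⟨⟨P, f⟩, hf⟩))
  | exact (x₀ x₁ x₂ : {x : FGProjEnd R // W x}) (h : FGProjEnd.ShortExact x₀.1 x₁.1 x₂.1) :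
      K1Rel W (FreeAbelianGroup.of x₁ - (FreeAbelianGroup.of x₀ + FreeAbelianGroup.of x₂))

/-- The abelian group with one generator `[x]` for each endomorphism `x` of a finitely generated
projective module satisfying `W`, and the relations `K1Rel W`. -/
def K1Presented (W : FGProjEnd R → Prop) : Type (u + 1) :=
  FreeAbelianGroup {x : FGProjEnd R // W x} ⧸ AddSubgroup.closure {a | K1Rel W a}

instance (W : FGProjEnd R → Prop) : AddCommGroup (K1Presented W) :=
  inferInstanceAs (AddCommGroup
    (FreeAbelianGroup {x : FGProjEnd R // W x} ⧸ AddSubgroup.closure {a | K1Rel W a}))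

/-- The class `[x]` of a generator. -/
def K1Presented.mk {W : FGProjEnd R → Prop} (x : FGProjEnd R) (hx : W x) : K1Presented W :=
  QuotientAddGroup.mk' (AddSubgroup.closure {a | K1Rel W a}) (FreeAbelianGroup.of ⟨x, hx⟩)

theorem K1Presented.mk_comp {W : FGProjEnd R → Prop} (P : Type u) [AddCommGroup P] [Module R P]
    [Module.Finite R P] [Module.Projective R P] (g f : P →ₗ[R] P) (hg : W ⟨P, g⟩) (hf : W ⟨P, f⟩)
    (hgf : W ⟨P, g ∘ₗ f⟩) :
    K1Presented.mk ⟨P, g ∘ₗ f⟩ hgf = K1Presented.mk ⟨P, g⟩ hg + K1Presented.mk ⟨P, f⟩ hf :=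
  sub_eq_zero.1 ((QuotientAddGroup.eq_zero_iff _).2
    (AddSubgroup.subset_closure (K1Rel.comp P g f hg hf hgf)))

theorem K1Presented.mk_exact {W : FGProjEnd R → Prop} (x₀ x₁ x₂ : FGProjEnd R) (h₀ : W x₀)
    (h₁ : W x₁) (h₂ : W x₂) (h : FGProjEnd.ShortExact x₀ x₁ x₂) :
    K1Presented.mk x₁ h₁ = K1Presented.mk x₀ h₀ + K1Presented.mk x₂ h₂ :=
  sub_eq_zero.1 ((QuotientAddGroup.eq_zero_iff _).2
    (AddSubgroup.subset_closure (K1Rel.exact ⟨x₀, h₀⟩ ⟨x₁, h₁⟩ ⟨x₂, h₂⟩ h)))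

variable (R) in
/-- The classical group `K₁(R)`: generators are the automorphisms of finitely generated projective
`R`-modules. -/
abbrev K1 : Type (u + 1) := K1Presented (FGProjEnd.IsAuto (R := R))

/-- The group `K₁(R, Sig)`, for `i : R → R_Sig` the canonical map: generators are the endomorphisms
of finitely generated projective `R`-modules that become invertible over `R_Sig`. (In the relation
for short exact sequences, the middle map becomes invertible as soon as the outer two do.) -/
abbrev K1Loc (i : R →+* S) : Type (u + 1) := K1Presented (FGProjEnd.BecomesAuto i)

/-- The homomorphism `K₁(R, Sig) → K₁(R_Sig)`, `[f] ↦ [id ⊗_R f]`. -/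
def K1Loc.toK1 (i : R →+* S) : K1Loc i →+ K1 S :=
  QuotientAddGroup.lift (AddSubgroup.closure {a | K1Rel (FGProjEnd.BecomesAuto i) a})
    (FreeAbelianGroup.lift fun x : {x : FGProjEnd R // x.BecomesAuto i} =>
      (K1Presented.mk (x.1.baseChange i) x.2 : K1 S))
    (by
      rw [AddSubgroup.closure_le]
      rintro _ (⟨P, g, f, hg, hf, hgf⟩ | ⟨x₀, x₁, x₂, h⟩)
      · simp only [SetLike.mem_coe, AddMonoidHom.mem_ker, map_sub, map_add,
          FreeAbelianGroup.lift_apply_of]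
        have key : ∀ (k : BaseChange i P →ₗ[S] BaseChange i P)
            (hk : FGProjEnd.IsAuto (⟨BaseChange i P, k⟩ : FGProjEnd S)),
            k = BaseChange.map i g ∘ₗ BaseChange.map i f →
            (K1Presented.mk ⟨BaseChange i P, k⟩ hk : K1 S) =
              K1Presented.mk ⟨BaseChange i P, BaseChange.map i g⟩ hg +
                K1Presented.mk ⟨BaseChange i P, BaseChange.map i f⟩ hf := by
          rintro k hk rfl
          exact K1Presented.mk_comp (W := FGProjEnd.IsAuto) _ _ _ hg hf hk
        exact sub_eq_zero.2 (key _ hgf (BaseChange.map_comp i g f))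
      · simp only [SetLike.mem_coe, AddMonoidHom.mem_ker, map_sub, map_add,
          FreeAbelianGroup.lift_apply_of]
        exact sub_eq_zero.2 (K1Presented.mk_exact (W := FGProjEnd.IsAuto) _ _ _ x₀.2 x₁.2 x₂.2
          (h.baseChange i)))

/-- The defining formula of `K1Loc.toK1` on generators. -/
theorem K1Loc.toK1_mk (i : R →+* S) (x : FGProjEnd R) (hx : x.BecomesAuto i) :
    K1Loc.toK1 i (K1Presented.mk x hx) = K1Presented.mk (x.baseChange i) hx :=
  FreeAbelianGroup.lift_apply_of _ _

end K1

end

/-! Write R_Σ for the localization. Every matrix over R_Σ is a fraction V = C A⁻¹ B with C, A, B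
over R and A invertible over R_Σ (`IsUniversalLocalization.representable`). If V is square, it is
the Schur complement of M = (A B; -C 0): over R_Σ, M = (A 0; -C V)(1 A⁻¹B; 0 1). Hence, if V is
invertible, so is M over R_Σ, and [V] = α[M] - α[A]. This gives surjectivity, and it suggests the
inverse [V] ↦ [M] - [A], which is `kdetExt`. The hard point is that [M] - [A] does not depend on the
chosen fraction, although two fractions for V are only known to agree over R_Σ.

To control this, a formal row fraction c A⁻¹ B is tested in contexts (N, p, q): its value `fracVal`
is the class of the block matrix with Schur complement N + p c A⁻¹ B q, divided by [A]. Formal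
fractions modulo equality of all values form an R-module `LocRow`. A matrix over R that becomes
invertible over R_Σ acts invertibly on it, the inverse being given by formal left multiplication
(`LocRow.isUnit_map_toAddMonoidEnd`). By the universal property the action of R extends to R_Σ.
Solving linear systems in this R_Σ-module shows that a fraction equal over R_Σ to a row d over R has
the same values as d (`LocRow.mk_eq_of_mul_eq`). Row by row this becomes
`kdet_fromBlocks_of_mul_eq`; applied to the difference of two fractions it gives the independence
statement `kdet_fromBlocks_eq_of_mul_eq`.

Block operations then show that `kdetExt` is multiplicative, also on block triangular matrices.
Completing automorphisms of projective modules by the identity turns such a function into a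
homomorphism on K₁ (`IsDetLike.exists_hom`), which is a left inverse of α because `kdetExt`
restricts to `kdet` on matrices over R.

Adjoining a zero to the group, as the class of matrices that do not become invertible, lets the
contexts N be arbitrary. `DetectsUnits` makes one matrix calculus serve both K₁(R, Σ) and K₁(R_Σ).
-/

noncomputable section

/-! ### Block matrices over noncommutative rings -/

namespace Matrix

variable {R : Type*} [Ring R] {m n : Type*} [Fintype m] [DecidableEq m] [Fintype n]
  [DecidableEq n]

theorem isUnit_fromBlocks_one_left (B : Matrix m n R) :
    IsUnit (fromBlocks (1 : Matrix m m R) B 0 (1 : Matrix n n R)) :=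
  isUnit_iff_exists.2 ⟨fromBlocks 1 (-B) 0 1, by simp [fromBlocks_multiply, fromBlocks_one], by
    simp [fromBlocks_multiply, fromBlocks_one]⟩

theorem isUnit_fromBlocks_diagonal {A : Matrix m m R} {D : Matrix n n R} :
    IsUnit (fromBlocks A 0 0 D) ↔ IsUnit A ∧ IsUnit D := by
  constructor
  · intro h
    obtain ⟨Z, h1, h2⟩ := isUnit_iff_exists.1 h
    rw [← fromBlocks_toBlocks Z, ← fromBlocks_one, fromBlocks_multiply, fromBlocks_inj] at h1 h2
    simp only [Matrix.zero_mul, Matrix.mul_zero, add_zero, zero_add] at h1 h2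
    exact ⟨isUnit_iff_exists.2 ⟨_, h1.1, h2.1⟩, isUnit_iff_exists.2 ⟨_, h1.2.2.2, h2.2.2.2⟩⟩
  · rintro ⟨hA, hD⟩
    obtain ⟨A', h1, h2⟩ := isUnit_iff_exists.1 hA
    obtain ⟨D', h3, h4⟩ := isUnit_iff_exists.1 hD
    exact isUnit_iff_exists.2 ⟨fromBlocks A' 0 0 D', by
      simp [fromBlocks_multiply, fromBlocks_one, h1, h3], by
      simp [fromBlocks_multiply, fromBlocks_one, h2, h4]⟩

theorem fromBlocks_upper_eq_mul (A : Matrix m m R) (B : Matrix m n R) (D : Matrix n n R) :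
    fromBlocks A B 0 D = fromBlocks 1 0 0 D * (fromBlocks 1 B 0 1 * fromBlocks A 0 0 1) := by
  simp [fromBlocks_multiply]

/-- Over a ring that is not Dedekind finite, a block triangular matrix can be invertible although
neither diagonal block is. Once one of them is a unit, two of the three factors in
`fromBlocks_upper_eq_mul` are units and cancel. -/
theorem isUnit_fromBlocks_upper {A : Matrix m m R} {B : Matrix m n R} {D : Matrix n n R}
    (h : IsUnit A ∨ IsUnit D) : IsUnit (fromBlocks A B 0 D) ↔ IsUnit A ∧ IsUnit D := by
  rw [fromBlocks_upper_eq_mul]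
  have hB := isUnit_fromBlocks_one_left (R := R) B
  rcases h with h | h
  · have hA : IsUnit (fromBlocks A 0 0 (1 : Matrix n n R)) :=
      isUnit_fromBlocks_diagonal.2 ⟨h, isUnit_one⟩
    obtain ⟨w, hw⟩ := hB.mul hA
    rw [← hw, Units.isUnit_mul_units, isUnit_fromBlocks_diagonal]
    simp [h]
  · have hD : IsUnit (fromBlocks (1 : Matrix m m R) 0 0 D) :=
      isUnit_fromBlocks_diagonal.2 ⟨isUnit_one, h⟩
    obtain ⟨w, hw⟩ := hD
    obtain ⟨w', hw'⟩ := hB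
    rw [← hw, Units.isUnit_units_mul, ← hw', Units.isUnit_units_mul, isUnit_fromBlocks_diagonal]
    simp [h]

theorem isUnit_submatrix_equiv_ring (e : n ≃ m) {A : Matrix m m R} :
    IsUnit (A.submatrix e e) ↔ IsUnit A := by
  have hs : A = (A.submatrix e e).submatrix e.symm e.symm := by ext; simp
  refine ⟨fun hA => ?_, fun hA => ?_⟩
  · rw [hs]
    obtain ⟨A', h1, h2⟩ := isUnit_iff_exists.1 hA
    exact isUnit_iff_exists.2 ⟨A'.submatrix e.symm e.symm, by
      rw [submatrix_mul_equiv, h1, submatrix_one_equiv], by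
      rw [submatrix_mul_equiv, h2, submatrix_one_equiv]⟩
  · obtain ⟨A', h1, h2⟩ := isUnit_iff_exists.1 hA
    exact isUnit_iff_exists.2 ⟨A'.submatrix e e, by
      rw [submatrix_mul_equiv, h1, submatrix_one_equiv], by
      rw [submatrix_mul_equiv, h2, submatrix_one_equiv]⟩

end Matrix

/-! ### The class of a matrix in `K₁` -/

open Matrix

section KDet

variable {R : Type u} [Ring R]

/-- The endomorphism `v ↦ v A` of the free module of row vectors. -/
def matEnd {n : Type} [Fintype n] (A : Matrix n n R) : FGProjEnd R where
  P := n → R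
  hom := A.vecMulLinear

/-- The predicate `W` holds for a square matrix if and only if the matrix becomes invertible
along `h`. -/
structure DetectsUnits {T : Type u} [Ring T] (W : FGProjEnd R → Prop) (h : R →+* T) : Prop where
  iff_isUnit : ∀ {n : Type} [Fintype n] [DecidableEq n] (A : Matrix n n R),
    W (matEnd A) ↔ IsUnit (A.map h)

open Classical in
/-- The class of a square matrix in `K₁`, written multiplicatively; matrices that do not satisfy
`W` have class `0`. -/
def kdet (W : FGProjEnd R → Prop) {n : Type} [Fintype n] (A : Matrix n n R) :
    WithZero (Multiplicative (K1Presented W)) :=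
  if hA : W (matEnd A) then ↑(Multiplicative.ofAdd (K1Presented.mk (matEnd A) hA)) else 0

variable {W : FGProjEnd R → Prop} {m n : Type} [Fintype m] [Fintype n]

theorem kdet_of {A : Matrix n n R} (hA : W (matEnd A)) :
    kdet W A = ↑(Multiplicative.ofAdd (K1Presented.mk (matEnd A) hA)) := dif_pos hA

theorem kdet_of_not {A : Matrix n n R} (hA : ¬ W (matEnd A)) : kdet W A = 0 := dif_neg hA

theorem kdet_ne_zero_iff {A : Matrix n n R} : kdet W A ≠ 0 ↔ W (matEnd A) := by
  by_cases hA : W (matEnd A)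
  · simp [kdet_of hA, hA]
  · simp [kdet_of_not hA, hA]

variable {T : Type u} [Ring T] [DecidableEq m] [DecidableEq n] {h : R →+* T} (hW : DetectsUnits W h)
include hW

omit [Ring T] [DecidableEq n] hW in
theorem kdet_mul_aux {A B : Matrix n n R} (hA : W (matEnd A)) (hB : W (matEnd B))
    (hAB : W (matEnd (A * B))) : kdet W (A * B) = kdet W A * kdet W B := by
  -- Matrices act on row vectors from the right, so `A * B` is the composite with `A` applied first;
  -- hence `add_comm`.
  rw [kdet_of hA, kdet_of hB, kdet_of hAB, ← WithZero.coe_mul, ← ofAdd_add, add_comm]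
  congr 2
  have e : (A * B).vecMulLinear = B.vecMulLinear ∘ₗ A.vecMulLinear :=
    LinearMap.ext fun v => (Matrix.vecMul_vecMul v A B).symm
  have key : ∀ (k : (n → R) →ₗ[R] (n → R)) (hk : W ⟨n → R, k⟩),
      k = B.vecMulLinear ∘ₗ A.vecMulLinear →
      K1Presented.mk ⟨n → R, k⟩ hk =
        K1Presented.mk (matEnd B) hB + K1Presented.mk (matEnd A) hA := by
    rintro k hk rfl
    exact K1Presented.mk_comp _ _ _ hB hA hk
  exact key _ hAB e

/-- A unit factor can be cancelled, so the product becomes invertible exactly when the other factor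
does. Without the hypothesis, two factors of class `0` could have an invertible product. -/
theorem kdet_mul {A B : Matrix n n R} (hAB : kdet W A ≠ 0 ∨ kdet W B ≠ 0) :
    kdet W (A * B) = kdet W A * kdet W B := by
  simp only [kdet_ne_zero_iff] at hAB
  by_cases hA : W (matEnd A)
  · by_cases hB : W (matEnd B)
    · refine kdet_mul_aux hA hB ?_
      rw [hW.iff_isUnit] at hA hB ⊢
      rw [Matrix.map_mul]
      exact hA.mul hB
    · rw [kdet_of_not hB, mul_zero, kdet_of_not]
      rw [hW.iff_isUnit] at hA hB ⊢
      rw [Matrix.map_mul]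
      obtain ⟨w, hw⟩ := hA
      rwa [← hw, Units.isUnit_units_mul]
  · have hB := hAB.resolve_left hA
    rw [kdet_of_not hA, zero_mul, kdet_of_not]
    rw [hW.iff_isUnit] at hA hB ⊢
    rw [Matrix.map_mul]
    obtain ⟨w, hw⟩ := hB
    rwa [← hw, Units.isUnit_mul_units]

theorem kdet_ne_zero_iff_isUnit {A : Matrix n n R} : kdet W A ≠ 0 ↔ IsUnit (A.map h) := by
  rw [kdet_ne_zero_iff, hW.iff_isUnit]

theorem kdet_one : kdet W (1 : Matrix n n R) = 1 := by
  have h1 : kdet W (1 : Matrix n n R) ≠ 0 := by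
    rw [kdet_ne_zero_iff_isUnit hW, Matrix.map_one _ h.map_zero h.map_one]
    exact isUnit_one
  have h2 := kdet_mul hW (Or.inl h1) (B := 1)
  rw [mul_one] at h2
  exact (mul_eq_left₀ h1).1 h2.symm

/-- Row vectors supported on `n` form an invariant submodule on which the matrix acts as `D`, and it
acts on the quotient as `A`; this is the relation for short exact sequences. -/
theorem kdet_fromBlocks_upper {A : Matrix m m R} {B : Matrix m n R} {D : Matrix n n R}
    (hAD : kdet W A ≠ 0 ∨ kdet W D ≠ 0) :
    kdet W (fromBlocks A B 0 D) = kdet W A * kdet W D := by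
  have hu := hAD
  rw [kdet_ne_zero_iff_isUnit hW, kdet_ne_zero_iff_isUnit hW] at hu
  have key := isUnit_fromBlocks_upper (B := B.map h) hu
  have em : (fromBlocks A B 0 D).map h = fromBlocks (A.map h) (B.map h) 0 (D.map h) := by
    rw [fromBlocks_map]; congr; ext; simp
  rw [← em, ← hW.iff_isUnit, ← hW.iff_isUnit, ← hW.iff_isUnit] at key
  by_cases hA : W (matEnd A)
  · by_cases hD : W (matEnd D)
    · rw [kdet_of hA, kdet_of hD, kdet_of (key.2 ⟨hA, hD⟩), ← WithZero.coe_mul, ← ofAdd_add]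
      congr 2
      rw [add_comm]
      let j : (n → R) →ₗ[R] (m ⊕ n → R) :=
        { toFun := fun v => Sum.elim 0 v
          map_add' := fun v w => by funext x; rcases x with x | x <;> simp
          map_smul' := fun c w => by funext x; rcases x with x | x <;> simp }
      refine K1Presented.mk_exact _ _ _ hD _ hA
        ⟨j, LinearMap.funLeft R R (Sum.inl : m → m ⊕ n), ?_, ?_, ?_, ?_, ?_⟩
      · intro v w hvw
        funext x
        exact congrFun hvw (Sum.inr x)
      · intro y
        constructor
        · intro hy
          refine ⟨y ∘ Sum.inr, ?_⟩
          funext x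
          rcases x with x | x
          · exact (congrFun hy x).symm
          · rfl
        · rintro ⟨x, rfl⟩
          rfl
      · intro v
        exact ⟨Sum.elim v 0, rfl⟩
      · refine LinearMap.ext fun v => ?_
        have e : ∀ v : n → R, Sum.elim (0 : m → R) v ᵥ* fromBlocks A B 0 D = Sum.elim (0 : m → R) (v ᵥ* D) :=
          fun v => by rw [Matrix.vecMul_fromBlocks]; simp
        exact e v
      · refine LinearMap.ext fun v => funext fun x => ?_
        have e : ∀ v : m ⊕ n → R,
            ((v ∘ Sum.inl) ᵥ* A) x = (v ᵥ* fromBlocks A B 0 D) (Sum.inl x) :=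
          fun v => by simp [Matrix.vecMul_fromBlocks]
        exact e v
    · rw [kdet_of_not hD, mul_zero, kdet_of_not]
      tauto
  · rw [kdet_of_not hA, zero_mul, kdet_of_not]
    tauto

omit [DecidableEq n] in
theorem kdet_of_isEmpty [IsEmpty n] (A : Matrix n n R) : kdet W A = 1 := by
  classical
  rw [Subsingleton.elim A 1, kdet_one hW]

/-- An isomorphism is read as a short exact sequence whose quotient is the zero module, here `Fin 0
→ R`, which contributes the class 0. -/
theorem kdet_submatrix_equiv (e : n ≃ m) (A : Matrix m m R) :
    kdet W (A.submatrix e e) = kdet W A := by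
  have key : W (matEnd (A.submatrix e e)) ↔ W (matEnd A) := by
    rw [hW.iff_isUnit, hW.iff_isUnit, ← isUnit_submatrix_equiv_ring e, submatrix_map]
  by_cases hA : W (matEnd A)
  · have hE : W (matEnd (0 : Matrix (Fin 0) (Fin 0) R)) :=
      kdet_ne_zero_iff.1 (by rw [kdet_of_isEmpty hW]; exact one_ne_zero)
    have h0 : K1Presented.mk (matEnd (0 : Matrix (Fin 0) (Fin 0) R)) hE = 0 := by
      have := kdet_of_isEmpty hW (0 : Matrix (Fin 0) (Fin 0) R)
      rw [kdet_of hE] at this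
      exact WithZero.coe_injective this
    rw [kdet_of hA, kdet_of (key.2 hA)]
    congr 2
    have := K1Presented.mk_exact (matEnd A) (matEnd (A.submatrix e e))
      (matEnd (0 : Matrix (Fin 0) (Fin 0) R)) hA (key.2 hA) hE ⟨LinearMap.funLeft R R e, 0, ?_, ?_, ?_, ?_, ?_⟩
    · rw [this, h0, add_zero]
    · exact fun v w hvw => (e.surjective.injective_comp_right) hvw
    · exact fun y => ⟨fun _ => ⟨y ∘ e.symm, funext fun x => congrArg y (e.symm_apply_apply x)⟩, fun _ => rfl⟩
    · exact fun y => ⟨0, Subsingleton.elim (α := Fin 0 → R) _ _⟩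
    · refine LinearMap.ext fun v => ?_
      change (v ∘ e) ᵥ* (A.submatrix e e) = (v ᵥ* A) ∘ e
      ext x
      simp only [Matrix.vecMul, dotProduct, Function.comp, submatrix_apply]
      exact e.sum_comp (fun y => v y * A y (e x))
    · exact LinearMap.ext fun v => Subsingleton.elim (α := Fin 0 → R) _ _
  · rw [kdet_of_not hA, kdet_of_not]
    tauto

theorem kdet_fromBlocks_lower {A : Matrix m m R} {C : Matrix n m R} {D : Matrix n n R}
    (hAD : kdet W A ≠ 0 ∨ kdet W D ≠ 0) :
    kdet W (fromBlocks A 0 C D) = kdet W A * kdet W D := by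
  rw [← kdet_submatrix_equiv hW (Equiv.sumComm n m)]
  change kdet W (Matrix.submatrix _ Sum.swap Sum.swap) = _
  rw [fromBlocks_submatrix_sum_swap_sum_swap, kdet_fromBlocks_upper hW hAD.symm, mul_comm]

theorem kdet_fromBlocks_one_left (B : Matrix m n R) :
    kdet W (fromBlocks (1 : Matrix m m R) B 0 (1 : Matrix n n R)) = 1 := by
  rw [kdet_fromBlocks_upper hW, kdet_one hW, kdet_one hW, one_mul]
  rw [kdet_one hW]; exact Or.inl one_ne_zero

theorem kdet_fromBlocks_one_right (C : Matrix n m R) :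
    kdet W (fromBlocks (1 : Matrix m m R) 0 C (1 : Matrix n n R)) = 1 := by
  rw [kdet_fromBlocks_lower hW, kdet_one hW, kdet_one hW, one_mul]
  rw [kdet_one hW]; exact Or.inl one_ne_zero

theorem kdet_mul_of_left_eq_one {A B : Matrix n n R} (hA : kdet W A = 1) :
    kdet W (A * B) = kdet W B := by
  rw [kdet_mul hW (Or.inl (by rw [hA]; exact one_ne_zero)), hA, one_mul]

theorem kdet_mul_of_right_eq_one {A B : Matrix n n R} (hB : kdet W B = 1) :
    kdet W (A * B) = kdet W A := by
  rw [kdet_mul hW (Or.inr (by rw [hB]; exact one_ne_zero)), hB, mul_one]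

/-- This and the next three lemmas are the elementary block operations: column operations multiply
on the right by a unipotent matrix, row operations on the left. The unipotent factor has class 1 and
so supplies the hypothesis of `kdet_mul`; the blocks are arbitrary. -/
theorem kdet_fromBlocks_add_col_right (A : Matrix m m R) (B : Matrix m n R) (C : Matrix n m R)
    (D : Matrix n n R) (Y : Matrix m n R) :
    kdet W (fromBlocks A (B + A * Y) C (D + C * Y)) = kdet W (fromBlocks A B C D) := by
  rw [← kdet_mul_of_right_eq_one hW (A := fromBlocks A B C D) (kdet_fromBlocks_one_left hW Y), fromBlocks_multiply]
  simp [add_comm]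

theorem kdet_fromBlocks_add_col_left (A : Matrix m m R) (B : Matrix m n R) (C : Matrix n m R)
    (D : Matrix n n R) (Y : Matrix n m R) :
    kdet W (fromBlocks (A + B * Y) B (C + D * Y) D) = kdet W (fromBlocks A B C D) := by
  rw [← kdet_mul_of_right_eq_one hW (A := fromBlocks A B C D) (kdet_fromBlocks_one_right hW Y), fromBlocks_multiply]
  simp

theorem kdet_fromBlocks_add_row_lower (A : Matrix m m R) (B : Matrix m n R) (C : Matrix n m R)
    (D : Matrix n n R) (Y : Matrix n m R) :
    kdet W (fromBlocks A B (C + Y * A) (D + Y * B)) = kdet W (fromBlocks A B C D) := by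
  rw [← kdet_mul_of_left_eq_one hW (B := fromBlocks A B C D) (kdet_fromBlocks_one_right hW Y), fromBlocks_multiply]
  simp [add_comm]

theorem kdet_fromBlocks_add_row_upper (A : Matrix m m R) (B : Matrix m n R) (C : Matrix n m R)
    (D : Matrix n n R) (Y : Matrix m n R) :
    kdet W (fromBlocks (A + Y * C) (B + Y * D) C D) = kdet W (fromBlocks A B C D) := by
  rw [← kdet_mul_of_left_eq_one hW (B := fromBlocks A B C D) (kdet_fromBlocks_one_left hW Y), fromBlocks_multiply]
  simp

end KDet

/-! ### Merging equal diagonal blocks -/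

section Merge

variable {R : Type u} [Ring R] {T : Type u} [Ring T] {W : FGProjEnd R → Prop} {h : R →+* T}
variable {k m n n' : Type} [Fintype k] [Fintype m] [Fintype n] [Fintype n']
  [DecidableEq k] [DecidableEq m] [DecidableEq n] [DecidableEq n']
variable (hW : DetectsUnits W h)
include hW

/-- The block rows are (A 0 B), (0 A B), (C₁ C₂ N). Add the first block column to the second, then
subtract the second block row from the first: this leaves (A 0 0), (0 A B), (C₁ C₁+C₂ N). It
expresses C₁A⁻¹B + C₂A⁻¹B = (C₁+C₂)A⁻¹B. -/
theorem kdet_merge_rows {A : Matrix n n R} (hA : kdet W A ≠ 0) (B : Matrix n m R)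
    (C₁ C₂ : Matrix m n R) (N : Matrix m m R) :
    kdet W (fromBlocks A (fromCols 0 B) (fromRows 0 C₁) (fromBlocks A B C₂ N)) =
      kdet W A * kdet W (fromBlocks A B (C₁ + C₂) N) := by
  rw [← kdet_fromBlocks_add_col_right hW _ _ _ _ (fromCols 1 0),
    ← kdet_fromBlocks_add_row_upper hW _ _ _ _ (fromCols (-1) 0),
    ← kdet_fromBlocks_lower hW (C := fromRows 0 C₁) (Or.inl hA)]
  congr 1
  ext (i | i | i) (j | j | j) <;>
    simp [Matrix.mul_apply, Matrix.one_apply, Matrix.add_apply, add_comm]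

/-- The transposed argument, for block rows (A 0 B₁), (0 A B₂), (C C N): add the first row to the
second and subtract the second column from the first. -/
theorem kdet_merge_cols {A : Matrix n n R} (hA : kdet W A ≠ 0) (B₁ B₂ : Matrix n m R)
    (C : Matrix m n R) (N : Matrix m m R) :
    kdet W (fromBlocks A (fromCols 0 B₁) (fromRows 0 C) (fromBlocks A B₂ C N)) =
      kdet W A * kdet W (fromBlocks A (B₁ + B₂) C N) := by
  rw [← kdet_fromBlocks_add_row_lower hW _ _ _ _ (fromRows 1 0),
    ← kdet_fromBlocks_add_col_left hW _ _ _ _ (fromRows (-1) 0),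
    ← kdet_fromBlocks_upper hW (B := fromCols 0 B₁) (Or.inl hA)]
  congr 1
  ext (i | i | i) (j | j | j) <;>
    simp [Matrix.mul_apply, Matrix.one_apply, Matrix.add_apply, add_comm]

end Merge

/-! ### Values of formal row fractions -/

section FracVal

variable {R : Type u} [Ring R] (W : FGProjEnd R → Prop)
variable {k l m n n' : Type} [Fintype k] [Fintype l] [Fintype m] [Fintype n] [Fintype n']

/-- The class of the block matrix whose Schur complement is `N + p (c A⁻¹ B) q`, divided by the
class of `A`. -/
def fracVal (c : Matrix Unit n R) (A : Matrix n n R) (B : Matrix n l R) (N : Matrix m m R)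
    (p : Matrix m Unit R) (q : Matrix l m R) : WithZero (Multiplicative (K1Presented W)) :=
  kdet W (fromBlocks A (B * q) (-(p * c)) N) / kdet W A

variable {W} {T : Type u} [Ring T] {h : R →+* T}
variable [DecidableEq k] [DecidableEq m] [DecidableEq n] [DecidableEq n']
variable (hW : DetectsUnits W h)
include hW

theorem fracVal_reindex (e : n' ≃ n) (c : Matrix Unit n R) (A : Matrix n n R) (B : Matrix n l R)
    (N : Matrix m m R) (p : Matrix m Unit R) (q : Matrix l m R) :
    fracVal W (c.submatrix id e) (A.submatrix e e) (B.submatrix e id) N p q =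
      fracVal W c A B N p q := by
  rw [fracVal, fracVal, kdet_submatrix_equiv hW e,
    ← kdet_submatrix_equiv hW (Equiv.sumCongr e (Equiv.refl m)) (fromBlocks A (B * q) (-(p * c)) N)]
  congr 2
  ext (i | i) (j | j) <;> simp [Matrix.mul_apply]

/-- The second summand is absorbed into the context of the first. So the value of a sum depends on
the first fraction only through its values, which makes addition on classes well defined. -/
theorem fracVal_add (c : Matrix Unit n R) (A : Matrix n n R) (B : Matrix n l R)
    (c' : Matrix Unit n' R) {A' : Matrix n' n' R} (hA' : kdet W A' ≠ 0) (B' : Matrix n' l R)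
    (N : Matrix m m R) (p : Matrix m Unit R) (q : Matrix l m R) :
    fracVal W (fromCols c c') (fromBlocks A 0 0 A') (fromRows B B') N p q =
      fracVal W c A B (fromBlocks A' (B' * q) (-(p * c')) N) (fromRows 0 p) (fromCols 0 q) /
        kdet W A' := by
  rw [fracVal, fracVal, div_div, kdet_fromBlocks_upper hW (Or.inr hA'),
    ← kdet_submatrix_equiv hW (Equiv.sumAssoc n n' m).symm]
  congr 2
  ext (i | i | i) (j | j | j) <;> simp [Matrix.mul_apply]

theorem fracVal_add_comm (c : Matrix Unit n R) (A : Matrix n n R) (B : Matrix n l R)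
    (c' : Matrix Unit n' R) (A' : Matrix n' n' R) (B' : Matrix n' l R)
    (N : Matrix m m R) (p : Matrix m Unit R) (q : Matrix l m R) :
    fracVal W (fromCols c c') (fromBlocks A 0 0 A') (fromRows B B') N p q =
      fracVal W (fromCols c' c) (fromBlocks A' 0 0 A) (fromRows B' B) N p q := by
  rw [← fracVal_reindex hW (Equiv.sumComm n n')]
  congr 1
  · ext i (j | j) <;> simp
  · ext (i | i) (j | j) <;> simp
  · ext (i | i) j <;> simp

theorem fracVal_add_same (c c' : Matrix Unit n R) {A : Matrix n n R} (hA : kdet W A ≠ 0)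
    (B : Matrix n l R) (N : Matrix m m R) (p : Matrix m Unit R) (q : Matrix l m R) :
    fracVal W (fromCols c c') (fromBlocks A 0 0 A) (fromRows B B) N p q =
      fracVal W (c + c') A B N p q := by
  have e := kdet_merge_rows hW hA (B * q) (-(p * c)) (-(p * c')) N
  have e' : fracVal W c A B (fromBlocks A (B * q) (-(p * c')) N) (fromRows 0 p) (fromCols 0 q) =
      kdet W (fromBlocks A (B * q) (-(p * c) + -(p * c')) N) := by
    rw [fracVal, div_eq_iff hA, mul_comm, ← e]
    congr 2
    · rw [mul_fromCols, Matrix.mul_zero]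
    · rw [fromRows_mul, Matrix.zero_mul]; ext (i | i) j <;> simp
  rw [fracVal_add hW _ _ _ _ hA, e', fracVal, Matrix.mul_add, neg_add]

theorem fracVal_zero {A : Matrix n n R} (hA : kdet W A ≠ 0) (B : Matrix n l R)
    (N : Matrix m m R) (p : Matrix m Unit R) (q : Matrix l m R) :
    fracVal W 0 A B N p q = kdet W N := by
  rw [fracVal, Matrix.mul_zero, neg_zero, kdet_fromBlocks_upper hW (Or.inl hA),
    mul_div_cancel_left₀ _ hA]

omit hW [DecidableEq m] [DecidableEq n] in
theorem fracVal_smul (r : R) (c : Matrix Unit n R) (A : Matrix n n R) (B : Matrix n l R)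
    (N : Matrix m m R) (p : Matrix m Unit R) (q : Matrix l m R) :
    fracVal W (r • c) A B N p q = fracVal W c A B N (p * (diagonal fun _ => r : Matrix Unit Unit R)) q := by
  rw [fracVal, fracVal, Matrix.mul_assoc, smul_eq_diagonal_mul]

/-- Adding `p * c` times the upper row clears the lower left block and leaves the Schur complement
in the lower right. -/
theorem fracVal_mul_self (c : Matrix Unit n R) {A : Matrix n n R} (hA : kdet W A ≠ 0)
    (B : Matrix n l R) (N : Matrix m m R) (p : Matrix m Unit R) (q : Matrix l m R) :
    fracVal W (c * A) A B N p q = kdet W (N + p * (c * B) * q) := by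
  rw [fracVal, ← kdet_fromBlocks_add_row_lower hW _ _ _ _ (p * c), Matrix.mul_assoc p c A,
    neg_add_cancel, kdet_fromBlocks_upper hW (Or.inl hA), mul_div_cancel_left₀ _ hA]
  simp only [Matrix.mul_assoc]

/-- The value of the formal fraction for `(a S⁻¹ b) (c A⁻¹ B)`. -/
theorem fracVal_act (a : Matrix Unit k R) {S : Matrix k k R} (hS : kdet W S ≠ 0)
    (b : Matrix k Unit R) (c : Matrix Unit n R) (A : Matrix n n R) (B : Matrix n l R)
    (N : Matrix m m R) (p : Matrix m Unit R) (q : Matrix l m R) :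
    fracVal W (fromCols a 0) (fromBlocks S (-(b * c)) 0 A) (fromRows 0 B) N p q =
      kdet W (fromBlocks S (fromCols (-(b * c)) 0) (fromRows 0 (-(p * a)))
        (fromBlocks A (B * q) 0 N)) / (kdet W S * kdet W A) := by
  rw [fracVal, kdet_fromBlocks_upper hW (Or.inl hS),
    ← kdet_submatrix_equiv hW (Equiv.sumAssoc k n m).symm]
  congr 2
  ext (i | i | i) (j | j | j) <;> simp [Matrix.mul_apply]

/-- Here `a S⁻¹ b` is moved into the context of `(c, A, B)`; hence left multiplication by it
respects equality of values. -/
theorem fracVal_act' (a : Matrix Unit k R) {S : Matrix k k R} (hS : kdet W S ≠ 0)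
    (b : Matrix k Unit R) (c : Matrix Unit n R) (A : Matrix n n R) (B : Matrix n l R)
    (N : Matrix m m R) (p : Matrix m Unit R) (q : Matrix l m R) :
    fracVal W (fromCols a 0) (fromBlocks S (-(b * c)) 0 A) (fromRows 0 B) N p q =
      fracVal W c A B (fromBlocks S 0 (-(p * a)) N) (fromRows b 0) (fromCols 0 q) / kdet W S := by
  rw [fracVal, fracVal, kdet_fromBlocks_upper hW (Or.inl hS), div_div, mul_comm (kdet W A),
    ← kdet_submatrix_equiv hW (((Equiv.sumAssoc n k m).symm.trans
      (Equiv.sumCongr (Equiv.sumComm n k) (Equiv.refl m))))]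
  congr 2
  ext (i | i | i) (j | j | j) <;> simp [Matrix.mul_apply]

theorem fracVal_act_mul (a : Matrix Unit k R) {S : Matrix k k R} (hS : kdet W S ≠ 0)
    (b : Matrix k Unit R) (c : Matrix Unit n R) (A : Matrix n n R) (B : Matrix n l R)
    (N : Matrix m m R) (p : Matrix m Unit R) (q : Matrix l m R) :
    fracVal W (fromCols (a * S) 0) (fromBlocks S (-(b * c)) 0 A) (fromRows 0 B) N p q =
      fracVal W (a * b * c) A B N p q := by
  have e := kdet_fromBlocks_add_row_lower hW S (fromCols (-(b * c)) 0) (fromRows 0 (-(p * (a * S))))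
    (fromBlocks A (B * q) 0 N) (fromRows 0 (p * a))
  have e1 : fromRows 0 (-(p * (a * S))) + fromRows 0 (p * a) * S = (0 : Matrix (n ⊕ m) k R) := by
    rw [fromRows_mul, Matrix.zero_mul, Matrix.mul_assoc]
    ext (i | i) j <;> simp
  have e2 : fromBlocks A (B * q) 0 N + fromRows 0 (p * a) * fromCols (-(b * c)) 0 =
      fromBlocks A (B * q) (-(p * (a * b * c))) N := by
    rw [fromRows_mul, Matrix.zero_mul, Matrix.mul_fromCols, Matrix.mul_neg, Matrix.mul_zero]
    simp only [Matrix.mul_assoc]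
    ext (i | i) (j | j) <;> simp
  rw [fracVal_act hW _ hS, ← e, e1, e2, kdet_fromBlocks_upper hW (Or.inl hS),
    mul_div_mul_left _ _ hS, fracVal]

theorem fracVal_act_mul' (a : Matrix Unit k R) {S : Matrix k k R} (hS : kdet W S ≠ 0)
    (b : Matrix k Unit R) (c : Matrix Unit n R) (A : Matrix n n R) (B : Matrix n l R)
    (N : Matrix m m R) (p : Matrix m Unit R) (q : Matrix l m R) :
    fracVal W (fromCols a 0) (fromBlocks S (-(S * b * c)) 0 A) (fromRows 0 B) N p q =
      fracVal W (a * b * c) A B N p q := by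
  have e := kdet_fromBlocks_add_col_right hW S (fromCols (-(S * b * c)) 0) (fromRows 0 (-(p * a)))
    (fromBlocks A (B * q) 0 N) (fromCols (b * c) 0)
  have e1 : fromCols (-(S * b * c)) 0 + S * fromCols (b * c) 0 = (0 : Matrix k (n ⊕ m) R) := by
    rw [mul_fromCols, Matrix.mul_zero, Matrix.mul_assoc]
    ext i (j | j) <;> simp
  have e2 : fromBlocks A (B * q) 0 N + fromRows 0 (-(p * a)) * fromCols (b * c) 0 =
      fromBlocks A (B * q) (-(p * (a * b * c))) N := by
    rw [fromRows_mul, Matrix.zero_mul, Matrix.mul_fromCols, Matrix.neg_mul, Matrix.mul_zero]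
    simp only [Matrix.mul_assoc]
    ext (i | i) (j | j) <;> simp
  rw [fracVal_act hW _ hS, ← e, e1, e2, kdet_fromBlocks_lower hW (Or.inl hS),
    mul_div_mul_left _ _ hS, fracVal]

/-- The two products share the left part `a S⁻¹`, so their two copies of `S` merge into one. The
result is a common normal form for proving additivity in the fraction acted on and in `b`. -/
theorem fracVal_act_add_act (a : Matrix Unit k R) {S : Matrix k k R} (hS : kdet W S ≠ 0)
    (b b' : Matrix k Unit R) (c : Matrix Unit n R) (A : Matrix n n R) (B : Matrix n l R)
    (c' : Matrix Unit n' R) {A' : Matrix n' n' R} (hA' : kdet W A' ≠ 0) (B' : Matrix n' l R)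
    (N : Matrix m m R) (p : Matrix m Unit R) (q : Matrix l m R) :
    fracVal W (fromCols (fromCols a 0) (fromCols a 0))
      (fromBlocks (fromBlocks S (-(b * c)) 0 A) 0 0 (fromBlocks S (-(b' * c')) 0 A'))
      (fromRows (fromRows 0 B) (fromRows 0 B')) N p q =
      kdet W (fromBlocks S (fromCols (-(b * c)) (fromCols (-(b' * c')) 0))
        (fromRows 0 (fromRows 0 (-(p * a))))
        (fromBlocks A (fromCols 0 (B * q)) 0 (fromBlocks A' (B' * q) 0 N))) /
          (kdet W S * kdet W A * kdet W A') := by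
  have hSA' : kdet W (fromBlocks S (-(b' * c')) 0 A') ≠ 0 := by
    rw [kdet_fromBlocks_upper hW (Or.inl hS)]; exact mul_ne_zero hS hA'
  have e := kdet_merge_cols hW hS (fromCols (-(b * c)) (fromCols 0 0))
    (fromCols 0 (fromCols (-(b' * c')) 0)) (fromRows 0 (fromRows 0 (-(p * a))))
    (fromBlocks A (fromCols 0 (B * q)) 0 (fromBlocks A' (B' * q) 0 N))
  have e1 : fromCols (-(b * c)) (fromCols 0 0) + fromCols 0 (fromCols (-(b' * c')) 0) =
      fromCols (-(b * c)) (fromCols (-(b' * c')) (0 : Matrix k m R)) := by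
    ext i (j | j | j) <;> simp
  -- Bring the two copies of `S` to the front, the shape required by `kdet_merge_cols`.
  let g : k ⊕ (k ⊕ (n ⊕ (n' ⊕ m))) ≃ ((k ⊕ n) ⊕ (k ⊕ n')) ⊕ m :=
    { toFun := Sum.elim (fun x => .inl (.inl (.inl x))) (Sum.elim (fun x => .inl (.inr (.inl x)))
        (Sum.elim (fun x => .inl (.inl (.inr x))) (Sum.elim (fun x => .inl (.inr (.inr x))) .inr)))
      invFun := Sum.elim (Sum.elim (Sum.elim .inl (fun x => .inr (.inr (.inl x))))
        (Sum.elim (fun x => .inr (.inl x)) (fun x => .inr (.inr (.inr (.inl x))))))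
        (fun x => .inr (.inr (.inr (.inr x))))
      left_inv := by rintro (x | x | x | x | x) <;> rfl
      right_inv := by rintro (((x | x) | (x | x)) | x) <;> rfl }
  rw [e1] at e
  rw [mul_assoc, ← mul_div_mul_left _ _ hS, ← e, fracVal, kdet_fromBlocks_upper hW (Or.inr hSA'),
    kdet_fromBlocks_upper hW (Or.inl hS), kdet_fromBlocks_upper hW (Or.inl hS),
    ← kdet_submatrix_equiv hW g]
  congr 1
  · congr 1
    ext (i | i | i | i | i) (j | j | j | j | j) <;> simp [Matrix.mul_apply, g]
  · ac_rfl

theorem fracVal_act_add (a : Matrix Unit k R) {S : Matrix k k R} (hS : kdet W S ≠ 0)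
    (b : Matrix k Unit R) (c : Matrix Unit n R) (A : Matrix n n R) (B : Matrix n l R)
    (c' : Matrix Unit n' R) {A' : Matrix n' n' R} (hA' : kdet W A' ≠ 0) (B' : Matrix n' l R)
    (N : Matrix m m R) (p : Matrix m Unit R) (q : Matrix l m R) :
    fracVal W (fromCols a 0) (fromBlocks S (-(b * fromCols c c')) 0 (fromBlocks A 0 0 A'))
      (fromRows 0 (fromRows B B')) N p q =
    fracVal W (fromCols (fromCols a 0) (fromCols a 0))
      (fromBlocks (fromBlocks S (-(b * c)) 0 A) 0 0 (fromBlocks S (-(b * c')) 0 A'))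
      (fromRows (fromRows 0 B) (fromRows 0 B')) N p q := by
  rw [fracVal_act_add_act hW _ hS _ _ _ _ _ _ hA', fracVal_act hW _ hS,
    kdet_fromBlocks_upper hW (Or.inr hA'), ← mul_assoc,
    ← kdet_submatrix_equiv hW (Equiv.sumCongr (Equiv.refl k) (Equiv.sumAssoc n n' m).symm)]
  congr 2
  ext (i | i | i | i) (j | j | j | j) <;> simp [Matrix.mul_apply]

/-- After `fracVal_act_add_act` there is one `S` but still two copies of `A`; these share their
right part and are merged by `kdet_merge_rows`. -/
theorem fracVal_add_act (a : Matrix Unit k R) {S : Matrix k k R} (hS : kdet W S ≠ 0)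
    (b b' : Matrix k Unit R) (c : Matrix Unit n R) {A : Matrix n n R} (hA : kdet W A ≠ 0)
    (B : Matrix n l R) (N : Matrix m m R) (p : Matrix m Unit R) (q : Matrix l m R) :
    fracVal W (fromCols a 0) (fromBlocks S (-((b + b') * c)) 0 A) (fromRows 0 B) N p q =
    fracVal W (fromCols (fromCols a 0) (fromCols a 0))
      (fromBlocks (fromBlocks S (-(b * c)) 0 A) 0 0 (fromBlocks S (-(b' * c)) 0 A))
      (fromRows (fromRows 0 B) (fromRows 0 B)) N p q := by
  have e := kdet_merge_rows hW hA (fromCols 0 (B * q)) (fromRows (-(b * c)) 0)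
    (fromRows (-(b' * c)) 0) (fromBlocks S 0 (-(p * a)) N)
  let g : n ⊕ (n ⊕ (k ⊕ m)) ≃ k ⊕ (n ⊕ (n ⊕ m)) :=
    { toFun := Sum.elim (fun x => .inr (.inl x)) (Sum.elim (fun x => .inr (.inr (.inl x)))
        (Sum.elim .inl (fun x => .inr (.inr (.inr x)))))
      invFun := Sum.elim (fun x => .inr (.inr (.inl x))) (Sum.elim .inl
        (Sum.elim (fun x => .inr (.inl x)) (fun x => .inr (.inr (.inr x)))))
      left_inv := by rintro (x | x | x | x) <;> rfl
      right_inv := by rintro (x | x | x | x) <;> rfl }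
  rw [fracVal_act_add_act hW _ hS _ _ _ _ _ _ hA, fracVal_act' hW _ hS, fracVal,
    ← kdet_submatrix_equiv hW g, div_div, mul_comm (kdet W A), ← mul_div_mul_right _ _ hA,
    mul_comm _ (kdet W A)]
  congr 1
  rw [mul_fromCols, Matrix.mul_zero, fromRows_mul, Matrix.zero_mul]
  trans kdet W A * kdet W (fromBlocks A (fromCols 0 (B * q))
      (fromRows (-(b * c)) 0 + fromRows (-(b' * c)) 0) (fromBlocks S 0 (-(p * a)) N))
  · congr 3
    ext (i | i) j <;> simp [Matrix.add_mul, add_comm]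
  · rw [← e]
    congr 1
    ext (i | i | i | i) (j | j | j | j) <;> simp [g]

end FracVal

/-! ### The module of row fractions -/

section LocRow

variable {R : Type u} [Ring R] {T : Type u} [Ring T] {W : FGProjEnd R → Prop} {h : R →+* T}

variable (W) in
/-- A formal row fraction `c A⁻¹ B`. -/
structure FormalRow (l : Type) where
  /-- the size of the denominator -/
  n : ℕ
  /-- the left factor -/
  c : Matrix Unit (Fin n) R
  /-- the denominator -/
  A : Matrix (Fin n) (Fin n) R
  /-- the right factor -/
  B : Matrix (Fin n) l R
  ne_zero : kdet W A ≠ 0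

/-- Formal row fractions are equivalent if they have the same values in all contexts. -/
def formalRowSetoid (W : FGProjEnd R → Prop) (l : Type) [Fintype l] : Setoid (FormalRow W l) where
  r x y := ∀ (m : Type) [Fintype m] [DecidableEq m] (N : Matrix m m R) (p : Matrix m Unit R)
    (q : Matrix l m R), fracVal W x.c x.A x.B N p q = fracVal W y.c y.A y.B N p q
  iseqv := ⟨fun _ _ _ _ _ _ _ => rfl, fun e m _ _ N p q => (e m N p q).symm,
    fun e e' m _ _ N p q => (e m N p q).trans (e' m N p q)⟩

/-- The module of row vectors of length `l` over the localization, as classes of formal row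
fractions. -/
def LocRow (_ : DetectsUnits W h) (l : Type) [Fintype l] : Type u :=
  Quotient (formalRowSetoid W l)

namespace LocRow

variable (hW : DetectsUnits W h) {l : Type} [Fintype l]
variable {k n n' : Type} [Fintype k] [Fintype n] [Fintype n']
  [DecidableEq k] [DecidableEq n] [DecidableEq n']

/-- The class of the formal fraction `c A⁻¹ B`. -/
def mk (c : Matrix Unit n R) (A : Matrix n n R) (B : Matrix n l R) (hA : kdet W A ≠ 0) :
    LocRow hW l :=
  Quotient.mk (formalRowSetoid W l)
    { n := Fintype.card n
      c := c.submatrix id (Fintype.equivFin n).symm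
      A := A.submatrix (Fintype.equivFin n).symm (Fintype.equivFin n).symm
      B := B.submatrix (Fintype.equivFin n).symm id
      ne_zero := by rwa [kdet_submatrix_equiv hW] }

theorem mk_eq_iff {c : Matrix Unit n R} {A : Matrix n n R} {B : Matrix n l R}
    {hA : kdet W A ≠ 0} {c' : Matrix Unit n' R} {A' : Matrix n' n' R} {B' : Matrix n' l R}
    {hA' : kdet W A' ≠ 0} : mk hW c A B hA = mk hW c' A' B' hA' ↔
      ∀ (m : Type) [Fintype m] [DecidableEq m] (N : Matrix m m R) (p : Matrix m Unit R)
        (q : Matrix l m R), fracVal W c A B N p q = fracVal W c' A' B' N p q := by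
  refine (Quotient.eq (r := formalRowSetoid W l)).trans ?_
  change (∀ (m : Type) [Fintype m] [DecidableEq m] (N : Matrix m m R) (p : Matrix m Unit R)
    (q : Matrix l m R), fracVal W (c.submatrix id _) (A.submatrix _ _) (B.submatrix _ id) N p q =
      fracVal W (c'.submatrix id _) (A'.submatrix _ _) (B'.submatrix _ id) N p q) ↔ _
  constructor <;> intro H m _ _ N p q <;> have e := H m N p q
  · rwa [fracVal_reindex hW, fracVal_reindex hW] at e
  · rwa [fracVal_reindex hW, fracVal_reindex hW]

theorem formal_eq_mk (x : FormalRow W l) :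
    (Quotient.mk (formalRowSetoid W l) x : LocRow hW l) = mk hW x.c x.A x.B x.ne_zero := by
  refine Quotient.sound ?_
  intro m _ _ N p q
  exact (fracVal_reindex hW _ _ _ _ _ _ _).symm

theorem exists_mk (x : LocRow hW l) : ∃ (n : ℕ) (c : Matrix Unit (Fin n) R)
    (A : Matrix (Fin n) (Fin n) R) (B : Matrix (Fin n) l R) (hA : kdet W A ≠ 0),
    x = mk hW c A B hA := by
  obtain ⟨x⟩ := x
  exact ⟨x.n, x.c, x.A, x.B, x.ne_zero, formal_eq_mk hW x⟩

include hW in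
theorem fromBlocks_ne_zero {A : Matrix n n R} {A' : Matrix n' n' R} {B : Matrix n n' R}
    (hA : kdet W A ≠ 0) (hA' : kdet W A' ≠ 0) : kdet W (fromBlocks A B 0 A') ≠ 0 := by
  rw [kdet_fromBlocks_upper hW (Or.inl hA)]
  exact mul_ne_zero hA hA'

instance : Add (LocRow hW l) where
  add := Quotient.map₂ (sa := formalRowSetoid W l) (sb := formalRowSetoid W l)
    (sc := formalRowSetoid W l)
    (fun x y =>
      { n := x.n + y.n
        c := (fromCols x.c y.c).submatrix id finSumFinEquiv.symm
        A := (fromBlocks x.A 0 0 y.A).submatrix finSumFinEquiv.symm finSumFinEquiv.symm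
        B := (fromRows x.B y.B).submatrix finSumFinEquiv.symm id
        ne_zero := by
          rw [kdet_submatrix_equiv hW]
          exact fromBlocks_ne_zero hW x.ne_zero y.ne_zero })
    (fun x x' hx y y' hy m _ _ N p q => by
      -- Replace one summand while the other sits in the context, swap the summands, and replace the
      -- other.
      rw [fracVal_reindex hW, fracVal_reindex hW, fracVal_add hW _ _ _ _ y.ne_zero, hx,
        ← fracVal_add hW _ _ _ _ y.ne_zero, fracVal_add_comm hW,
        fracVal_add hW _ _ _ _ x'.ne_zero, hy, ← fracVal_add hW _ _ _ _ x'.ne_zero,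
        fracVal_add_comm hW])

theorem mk_add_mk (c : Matrix Unit n R) (A : Matrix n n R) (B : Matrix n l R)
    (hA : kdet W A ≠ 0) (c' : Matrix Unit n' R) (A' : Matrix n' n' R) (B' : Matrix n' l R)
    (hA' : kdet W A' ≠ 0) : mk hW c A B hA + mk hW c' A' B' hA' =
      mk hW (fromCols c c') (fromBlocks A 0 0 A') (fromRows B B')
        (fromBlocks_ne_zero hW hA hA') := by
  refine Eq.trans (formal_eq_mk hW _) ((mk_eq_iff hW).2 fun m _ _ N p q => ?_)
  dsimp only
  rw [fracVal_reindex hW, ← fracVal_reindex hW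
    (Equiv.sumCongr (Fintype.equivFin n).symm (Fintype.equivFin n').symm)]
  congr 1
  · ext i (j | j) <;> simp
  · ext (i | i) (j | j) <;> simp
  · ext (i | i) j <;> simp

instance : Zero (LocRow hW l) where
  zero := mk hW (n := Fin 0) 0 1 0 (by rw [kdet_one hW]; exact one_ne_zero)

theorem mk_zero (A : Matrix n n R) (B : Matrix n l R) (hA : kdet W A ≠ 0) :
    mk hW 0 A B hA = 0 := by
  refine (mk_eq_iff hW).2 fun m _ _ N p q => ?_
  rw [fracVal_zero hW hA, fracVal_zero hW (by rw [kdet_one hW]; exact one_ne_zero)]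

theorem mk_add_same (c c' : Matrix Unit n R) (A : Matrix n n R) (B : Matrix n l R)
    (hA : kdet W A ≠ 0) : mk hW (c + c') A B hA = mk hW c A B hA + mk hW c' A B hA := by
  rw [mk_add_mk]
  exact (mk_eq_iff hW).2 fun m _ _ N p q => (fracVal_add_same hW c c' hA B N p q).symm

instance : Neg (LocRow hW l) where
  neg := Quotient.map (sa := formalRowSetoid W l) (sb := formalRowSetoid W l)
    (fun x => { x with c := (-1 : R) • x.c })
    (fun x x' hx m _ _ N p q => by
      dsimp only
      rw [fracVal_smul, fracVal_smul, hx])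

instance : SMul R (LocRow hW l) where
  smul r := Quotient.map (sa := formalRowSetoid W l) (sb := formalRowSetoid W l)
    (fun x => { x with c := r • x.c })
    (fun x x' hx m _ _ N p q => by
      dsimp only
      rw [fracVal_smul, fracVal_smul, hx])

theorem smul_mk (r : R) (c : Matrix Unit n R) (A : Matrix n n R) (B : Matrix n l R)
    (hA : kdet W A ≠ 0) : r • mk hW c A B hA = mk hW (r • c) A B hA := by
  refine Eq.trans (formal_eq_mk hW _) ((mk_eq_iff hW).2 fun m _ _ N p q => ?_)
  dsimp only
  rw [fracVal_smul, fracVal_smul, fracVal_reindex hW]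

theorem neg_mk (c : Matrix Unit n R) (A : Matrix n n R) (B : Matrix n l R)
    (hA : kdet W A ≠ 0) : -mk hW c A B hA = mk hW (-c) A B hA := by
  rw [← neg_one_smul R c, ← smul_mk]
  rfl

instance : AddCommGroup (LocRow hW l) :=
  { AddGroup.ofLeftAxioms (G := LocRow hW l)
      (fun x y z => by
        obtain ⟨n₁, c₁, A₁, B₁, h₁, rfl⟩ := exists_mk hW x
        obtain ⟨n₂, c₂, A₂, B₂, h₂, rfl⟩ := exists_mk hW y
        obtain ⟨n₃, c₃, A₃, B₃, h₃, rfl⟩ := exists_mk hW z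
        simp only [mk_add_mk]
        refine (mk_eq_iff hW).2 fun m _ _ N p q => ?_
        rw [← fracVal_reindex hW (Equiv.sumAssoc _ _ _)]
        congr 1
        · ext i ((j | j) | j) <;> simp
        · ext ((i | i) | i) ((j | j) | j) <;> simp
        · ext ((i | i) | i) j <;> simp)
      (fun x => by
        obtain ⟨n, c, A, B, hA, rfl⟩ := exists_mk hW x
        rw [← mk_zero hW A B hA, ← mk_add_same, zero_add])
      (fun x => by
        obtain ⟨n, c, A, B, hA, rfl⟩ := exists_mk hW x
        rw [neg_mk, ← mk_add_same, neg_add_cancel, mk_zero]) with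
    add_comm := fun x y => by
      obtain ⟨n₁, c₁, A₁, B₁, h₁, rfl⟩ := exists_mk hW x
      obtain ⟨n₂, c₂, A₂, B₂, h₂, rfl⟩ := exists_mk hW y
      rw [mk_add_mk, mk_add_mk]
      exact (mk_eq_iff hW).2 fun m _ _ N p q => fracVal_add_comm hW _ _ _ _ _ _ _ _ _ }

theorem smul_add_aux (r : R) (x y : LocRow hW l) : r • (x + y) = r • x + r • y := by
  obtain ⟨n₁, c₁, A₁, B₁, h₁, rfl⟩ := exists_mk hW x
  obtain ⟨n₂, c₂, A₂, B₂, h₂, rfl⟩ := exists_mk hW y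
  rw [mk_add_mk, smul_mk, smul_mk, smul_mk, mk_add_mk]
  congr 1
  ext i (j | j) <;> simp

instance : Module R (LocRow hW l) where
  one_smul x := by
    obtain ⟨n, c, A, B, hA, rfl⟩ := exists_mk hW x
    rw [smul_mk, one_smul]
  mul_smul r s x := by
    obtain ⟨n, c, A, B, hA, rfl⟩ := exists_mk hW x
    rw [smul_mk, smul_mk, smul_mk, mul_smul]
  smul_zero r := by
    have e := smul_add_aux hW (l := l) r 0 0
    rwa [add_zero, left_eq_add] at e
  smul_add := smul_add_aux hW
  add_smul r s x := by
    obtain ⟨n, c, A, B, hA, rfl⟩ := exists_mk hW x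
    rw [smul_mk, smul_mk, smul_mk, add_smul, mk_add_same]
  zero_smul x := by
    obtain ⟨n, c, A, B, hA, rfl⟩ := exists_mk hW x
    rw [smul_mk, zero_smul, mk_zero]

/-- The fraction `c A⁻¹ B` as a linear function of `c`. -/
def mkLinear (A : Matrix n n R) (B : Matrix n l R) (hA : kdet W A ≠ 0) :
    Matrix Unit n R →ₗ[R] LocRow hW l where
  toFun c := mk hW c A B hA
  map_add' c c' := mk_add_same hW c c' A B hA
  map_smul' r c := (smul_mk hW r c A B hA).symm

theorem mk_mul_eq (c : Matrix Unit n R) (A : Matrix n n R) (B : Matrix n l R)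
    (hA : kdet W A ≠ 0) [DecidableEq l] :
    mk hW (c * A) A B hA = mk hW (c * B) 1 1 (by rw [kdet_one hW]; exact one_ne_zero) := by
  have h1 : kdet W (1 : Matrix l l R) ≠ 0 := by rw [kdet_one hW]; exact one_ne_zero
  refine (mk_eq_iff hW).2 fun m _ _ N p q => ?_
  rw [fracVal_mul_self hW _ hA]
  have := fracVal_mul_self hW (c * B) h1 1 N p q
  simp only [Matrix.mul_one] at this
  exact this.symm

/-- Left multiplication by the fraction `a S⁻¹ b` on row fractions, as a function. -/
def actFun (a : Matrix Unit k R) (S : Matrix k k R) (hS : kdet W S ≠ 0) (b : Matrix k Unit R) :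
    LocRow hW l → LocRow hW l :=
  Quotient.lift (s := formalRowSetoid W l)
    (fun x => mk hW (fromCols a 0) (fromBlocks S (-(b * x.c)) 0 x.A) (fromRows 0 x.B)
      (fromBlocks_ne_zero hW hS x.ne_zero))
    (fun x y hxy => by
      refine (mk_eq_iff hW).2 fun m _ _ N p q => ?_
      rw [fracVal_act' hW _ hS, fracVal_act' hW _ hS, hxy])

theorem actFun_mk (a : Matrix Unit k R) (S : Matrix k k R) (hS : kdet W S ≠ 0)
    (b : Matrix k Unit R) (c : Matrix Unit n R) (A : Matrix n n R) (B : Matrix n l R)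
    (hA : kdet W A ≠ 0) : actFun hW a S hS b (mk hW c A B hA) =
      mk hW (fromCols a 0) (fromBlocks S (-(b * c)) 0 A) (fromRows 0 B)
        (fromBlocks_ne_zero hW hS hA) := by
  have hA' : kdet W (A.submatrix (Fintype.equivFin n).symm (Fintype.equivFin n).symm) ≠ 0 := by
    rwa [kdet_submatrix_equiv hW]
  refine (mk_eq_iff hW (hA := fromBlocks_ne_zero hW hS hA')).2 fun m _ _ N p q => ?_
  rw [fracVal_act' hW _ hS, fracVal_act' hW _ hS, fracVal_reindex hW]

/-- Left multiplication by the fraction `a S⁻¹ b` on row fractions. -/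
def act (a : Matrix Unit k R) (S : Matrix k k R) (hS : kdet W S ≠ 0) (b : Matrix k Unit R) :
    LocRow hW l →+ LocRow hW l :=
  AddMonoidHom.mk' (actFun hW a S hS b) (fun x y => by
    obtain ⟨n₁, c₁, A₁, B₁, h₁, rfl⟩ := exists_mk hW x
    obtain ⟨n₂, c₂, A₂, B₂, h₂, rfl⟩ := exists_mk hW y
    rw [mk_add_mk, actFun_mk, actFun_mk, actFun_mk, mk_add_mk]
    exact (mk_eq_iff hW).2 fun m _ _ N p q => fracVal_act_add hW _ hS _ _ _ _ _ h₂ _ _ _ _)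

theorem act_mk (a : Matrix Unit k R) (S : Matrix k k R) (hS : kdet W S ≠ 0) (b : Matrix k Unit R)
    (c : Matrix Unit n R) (A : Matrix n n R) (B : Matrix n l R) (hA : kdet W A ≠ 0) :
    act hW a S hS b (mk hW c A B hA) =
      mk hW (fromCols a 0) (fromBlocks S (-(b * c)) 0 A) (fromRows 0 B)
        (fromBlocks_ne_zero hW hS hA) :=
  actFun_mk hW a S hS b c A B hA

/-! ### Inverting matrices on the module of row fractions -/

variable (S : Matrix k k R) (hS : kdet W S ≠ 0)

theorem act_mul_left (a : Matrix Unit k R) (b : Matrix k Unit R) (x : LocRow hW l) :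
    act hW (a * S) S hS b x = (a * b) () () • x := by
  obtain ⟨n, c, A, B, hA, rfl⟩ := exists_mk hW x
  have e : (a * b) () () • c = a * b * c := by ext i j; simp [Matrix.mul_apply (M := a * b)]
  rw [act_mk, smul_mk, e]
  exact (mk_eq_iff hW).2 fun m _ _ N p q => fracVal_act_mul hW _ hS _ _ _ _ _ _ _

theorem act_mul_right (a : Matrix Unit k R) (b : Matrix k Unit R) (x : LocRow hW l) :
    act hW a S hS (S * b) x = (a * b) () () • x := by
  obtain ⟨n, c, A, B, hA, rfl⟩ := exists_mk hW x
  have e : (a * b) () () • c = a * b * c := by ext i j; simp [Matrix.mul_apply (M := a * b)]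
  rw [act_mk, smul_mk, e]
  exact (mk_eq_iff hW).2 fun m _ _ N p q => fracVal_act_mul' hW _ hS _ _ _ _ _ _ _

/-- The action of `a S⁻¹ b` as a linear function of `a`. -/
def actLeft (b : Matrix k Unit R) (x : LocRow hW l) : Matrix Unit k R →ₗ[R] LocRow hW l where
  toFun a := act hW a S hS b x
  map_add' a a' := by
    obtain ⟨n, c, A, B, hA, rfl⟩ := exists_mk hW x
    rw [act_mk, act_mk, act_mk, ← mk_add_same]
    congr 1
    ext i (j | j) <;> simp
  map_smul' r a := by
    obtain ⟨n, c, A, B, hA, rfl⟩ := exists_mk hW x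
    rw [act_mk, act_mk, RingHom.id_apply, smul_mk]
    congr 1
    ext i (j | j) <;> simp

/-- The action of `a S⁻¹ b` as an additive function of `b`. -/
def actRight (a : Matrix Unit k R) (x : LocRow hW l) : Matrix k Unit R →+ LocRow hW l :=
  AddMonoidHom.mk' (fun b => act hW a S hS b x) (fun b b' => by
    obtain ⟨n, c, A, B, hA, rfl⟩ := exists_mk hW x
    rw [act_mk, act_mk, act_mk, mk_add_mk]
    exact (mk_eq_iff hW).2 fun m _ _ N p q => fracVal_add_act hW _ hS _ _ _ hA _ _ _ _)

theorem act_smul (a : Matrix Unit k R) (b : Matrix k Unit R) (r : R) (x : LocRow hW l) :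
    act hW a S hS b (r • x) = act hW a S hS (b * (diagonal fun _ => r : Matrix Unit Unit R)) x := by
  obtain ⟨n, c, A, B, hA, rfl⟩ := exists_mk hW x
  rw [smul_mk, act_mk, act_mk, Matrix.mul_assoc, smul_eq_diagonal_mul]

include hS in
-- The (i, j) entry of the inverse is left multiplication by the formal fraction e_i S⁻¹ e_j.
-- Linearity in the left factor collects one product into (e_i S) S⁻¹ e_j, additivity in the right
-- factor collects the other into e_i S⁻¹ (S e_j); both act as the scalar e_i e_j.
theorem isUnit_map_toAddMonoidEnd :
    IsUnit (S.map (Module.toAddMonoidEnd R (LocRow hW l))) := by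
  refine isUnit_iff_exists.2 ⟨Matrix.of fun i j =>
    (act hW (Matrix.single () i 1) S hS (Matrix.single j () 1) : AddMonoid.End (LocRow hW l)),
    ?_, ?_⟩
  · ext i j x
    have e : Matrix.single () i (1 : R) * S = ∑ t, S i t • (Matrix.single () t 1 : Matrix Unit k R) := by
      ext a b
      simp [Matrix.sum_apply, Matrix.single_apply, Matrix.mul_apply]
    have e2 : act hW (Matrix.single () i (1 : R) * S) S hS (Matrix.single j () 1) x =
        ∑ t, S i t • act hW (Matrix.single () t 1) S hS (Matrix.single j () 1) x := by
      rw [e]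
      exact (map_sum (actLeft hW S hS (Matrix.single j () 1) x) _ _).trans
        (Finset.sum_congr rfl fun t _ => map_smul _ _ _)
    rw [act_mul_left] at e2
    rw [Matrix.mul_apply]
    refine (AddMonoidHom.finsetSum_apply _ _ x).trans (Eq.trans e2.symm ?_)
    rcases eq_or_ne i j with rfl | hij
    · simp
    · simp [hij, Matrix.mul_apply, Matrix.single_apply]
  · ext i j x
    have e : S * Matrix.single j () (1 : R) = ∑ t, Matrix.single t () (1 : R) *
        (diagonal fun _ => S t j : Matrix Unit Unit R) := by
      ext a b
      simp [Matrix.sum_apply, Matrix.single_apply, Matrix.mul_apply]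
    have e2 : act hW (Matrix.single () i 1) S hS (S * Matrix.single j () (1 : R)) x =
        ∑ t, act hW (Matrix.single () i 1) S hS (Matrix.single t () 1) (S t j • x) := by
      rw [e]
      exact (map_sum (actRight hW S hS (Matrix.single () i 1) x) _ _).trans
        (Finset.sum_congr rfl fun t _ => (act_smul hW S hS _ _ _ _).symm)
    rw [act_mul_right] at e2
    rw [Matrix.mul_apply]
    refine (AddMonoidHom.finsetSum_apply _ _ x).trans (Eq.trans e2.symm ?_)
    rcases eq_or_ne i j with rfl | hij
    · simp
    · simp [hij, Matrix.mul_apply, Matrix.single_apply]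

end LocRow

end LocRow

/-! ### Row fractions and the universal localization -/

section Universal

variable {R : Type u} [Ring R] {T : Type u} [Ring T] {W : FGProjEnd R → Prop} {h : R →+* T}
variable {k l m n : Type} [Fintype k] [Fintype l] [Fintype m] [Fintype n]
  [DecidableEq k] [DecidableEq l] [DecidableEq m] [DecidableEq n]
variable (hW : DetectsUnits W h)

/-- The action of `R` on the module of row fractions extends to `T`. -/
def ExtendsAction (l : Type) [Fintype l] (g : T →+* AddMonoid.End (LocRow hW l)) : Prop :=
  ∀ r x, g (h r) x = r • x

variable {hW}

/-- View row fractions as a `T`-module through `g`. Let x be the column of the fractions e_i A⁻¹ B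
and y that of the fractions e_t 1⁻¹ 1. Then A x = B y by `LocRow.mk_mul_eq`; as A is invertible over
`T`, x = Z y, and so c x = c Z y = d y. -/
theorem LocRow.mk_eq_of_mul_eq {g : T →+* AddMonoid.End (LocRow hW l)}
    (hg : ExtendsAction hW l g) {c : Matrix Unit n R} {A : Matrix n n R} {B : Matrix n l R}
    (hA : kdet W A ≠ 0) {Z : Matrix n l T} (hZ : A.map h * Z = B.map h) {d : Matrix Unit l R}
    (hd : c.map h * Z = d.map h) :
    LocRow.mk hW c A B hA = LocRow.mk hW d (1 : Matrix l l R) 1 (by rw [kdet_one hW]; exact one_ne_zero) := by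
  have h1 : kdet W (1 : Matrix l l R) ≠ 0 := by rw [kdet_one hW]; exact one_ne_zero
  obtain ⟨A', hA', -⟩ := isUnit_iff_exists.1 ((kdet_ne_zero_iff_isUnit hW).1 hA)
  have hA'' : A' * A.map h = 1 := by
    obtain ⟨A₂, h₁, h₂⟩ := isUnit_iff_exists.1 ((kdet_ne_zero_iff_isUnit hW).1 hA)
    rwa [← left_inv_eq_right_inv h₂ hA']
  let lam := LocRow.mkLinear hW A B hA
  let lam1 := LocRow.mkLinear hW (1 : Matrix l l R) (1 : Matrix l l R) h1
  have expand : ∀ {k : Type} [Fintype k] [DecidableEq k] (f : Matrix Unit k R →ₗ[R] LocRow hW l)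
      (w : Matrix Unit k R), f w = ∑ j, g (h (w () j)) (f (Matrix.single () j 1)) := by
    intro k _ _ f w
    have e : w = ∑ j, w () j • (Matrix.single () j 1 : Matrix Unit k R) := by
      ext a b
      simp [Matrix.sum_apply, Matrix.single_apply]
    conv_lhs => rw [e]
    rw [map_sum]
    exact Finset.sum_congr rfl fun j _ => by rw [map_smul, hg]
  have key : ∀ w : Matrix Unit n R, lam (w * A) = lam1 (w * B) := fun w =>
    LocRow.mk_mul_eq hW w A B hA
  -- Associativity P(Qx) = (PQ)x for columns x of row fractions.
  have mulSum : ∀ {p k k' : Type} [Fintype k] [Fintype k'] (P : Matrix p k T) (Q : Matrix k k' T)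
      (x : k' → LocRow hW l) (i : p), ∑ j, g (P i j) (∑ t, g (Q j t) (x t)) =
        ∑ t, g ((P * Q) i t) (x t) := by
    intro p k k' _ _ P Q x i
    simp only [map_sum]
    rw [Finset.sum_comm]
    refine Finset.sum_congr rfl fun t _ => ?_
    rw [Matrix.mul_apply, map_sum]
    refine Eq.trans ?_ (AddMonoidHom.finsetSum_apply (M := LocRow hW l) (N := LocRow hW l)
      (fun j => g (P i j * Q j t)) Finset.univ (x t)).symm
    exact Finset.sum_congr rfl fun j _ => by rw [map_mul]; rfl
  have hz : ∀ i, lam (Matrix.single () i 1) = ∑ t, g (Z i t) (lam1 (Matrix.single () t 1)) := by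
    intro i
    have e1 : ∑ j, g (A' i j) (∑ t, g (A.map h j t) (lam (Matrix.single () t 1))) =
        lam (Matrix.single () i 1) := by
      refine (mulSum A' (A.map h) _ i).trans ?_
      rw [hA'', Finset.sum_eq_single i]
      · simp
      · intro b _ hb
        rw [Matrix.one_apply_ne hb.symm, map_zero]
        rfl
      · simp
    have e2 : ∀ j, ∑ t, g (A.map h j t) (lam (Matrix.single () t 1)) =
        ∑ t, g (B.map h j t) (lam1 (Matrix.single () t 1)) := by
      intro j
      have e3 := key (Matrix.single () j 1)
      rw [expand lam, expand lam1] at e3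
      have a1 : ∀ t, (Matrix.single () j (1 : R) * A) () t = A j t := by simp
      have a2 : ∀ t, (Matrix.single () j (1 : R) * B) () t = B j t := by simp
      simp only [a1, a2] at e3
      exact e3
    rw [← e1]
    simp only [e2]
    refine (mulSum A' (B.map h) _ i).trans ?_
    rw [← hZ, ← Matrix.mul_assoc, hA'', Matrix.one_mul]
  change lam c = lam1 d
  rw [expand lam, expand lam1]
  simp only [hz]
  refine (mulSum (c.map h) Z _ ()).trans ?_
  rw [hd]
  rfl

variable (hext : ∀ (l : Type) [Fintype l], ∃ g : T →+* AddMonoid.End (LocRow hW l),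
  ExtendsAction hW l g)
include hext

/-- Equality of the two row fractions, evaluated in the context `(N, p, 1)`. -/
theorem kdet_fromBlocks_of_row {c : Matrix Unit n R} {A : Matrix n n R} {B : Matrix n m R}
    (hA : kdet W A ≠ 0) {Z : Matrix n m T} (hZ : A.map h * Z = B.map h) {d : Matrix Unit m R}
    (hd : c.map h * Z = d.map h) (N : Matrix m m R) (p : Matrix m Unit R) :
    kdet W (fromBlocks A B (-(p * c)) N) = kdet W A * kdet W (N + p * d) := by
  obtain ⟨g, hg⟩ := hext m
  have h1 : kdet W (1 : Matrix m m R) ≠ 0 := by rw [kdet_one hW]; exact one_ne_zero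
  have e := (LocRow.mk_eq_iff hW).1 (LocRow.mk_eq_of_mul_eq hg hA hZ hd) m N p 1
  have e1 := fracVal_mul_self hW d h1 1 N p (1 : Matrix m m R)
  simp only [Matrix.mul_one] at e1
  rw [e1, fracVal, Matrix.mul_one, div_eq_iff hA, mul_comm] at e
  exact e

/-- If the Schur complement of a block matrix is defined over `R`, then it computes the class. -/
theorem kdet_fromBlocks_of_mul_eq {A : Matrix n n R} {B : Matrix n m R} {C : Matrix m n R}
    {D : Matrix m m R} (hA : kdet W A ≠ 0) {Z : Matrix n m T} (hZ : A.map h * Z = B.map h)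
    (hD : C.map h * Z = D.map h) (N : Matrix m m R) :
    kdet W (fromBlocks A B (-C) N) = kdet W A * kdet W (N + D) := by
  -- Row fractions handle one row at a time, so the rows of `C` and `D` are switched on one by one,
  -- with `N` general in the induction.
  have key : ∀ (s : Finset m) (N : Matrix m m R),
      kdet W (fromBlocks A B (-(Matrix.of fun i j => if i ∈ s then C i j else 0)) N) =
        kdet W A * kdet W (N + Matrix.of fun i j => if i ∈ s then D i j else 0) := by
    intro s
    induction s using Finset.induction_on with
    | empty =>
      intro N
      have e1 : (Matrix.of fun (i : m) (j : n) => if i ∈ (∅ : Finset m) then C i j else 0) = 0 := by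
        ext; simp
      have e2 : (Matrix.of fun (i : m) (j : m) => if i ∈ (∅ : Finset m) then D i j else 0) = 0 := by
        ext; simp
      rw [e1, e2, neg_zero, add_zero, kdet_fromBlocks_upper hW (Or.inl hA)]
    | insert a s ha ih =>
      intro N
      let Cs : Matrix m n R := Matrix.of fun i j => if i ∈ s then C i j else 0
      let c : Matrix Unit n R := Matrix.of fun _ j => C a j
      let d : Matrix Unit m R := Matrix.of fun _ j => D a j
      let p : Matrix m Unit R := Matrix.single a () 1
      have e1 : (Matrix.of fun i j => if i ∈ insert a s then C i j else 0) = p * c + Cs := by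
        ext i j
        rcases eq_or_ne i a with rfl | hia
        · simp [p, c, Cs, ha, Matrix.mul_apply]
        · simp [p, c, Cs, hia, Matrix.mul_apply, hia.symm]
      have e2 : (Matrix.of fun i j => if i ∈ insert a s then D i j else 0) =
          p * d + Matrix.of fun i j => if i ∈ s then D i j else 0 := by
        ext i j
        rcases eq_or_ne i a with rfl | hia
        · simp [p, d, ha, Matrix.mul_apply]
        · simp [p, d, hia, Matrix.mul_apply, hia.symm]
      -- Split row `a` off onto a second copy of `A`. Then `e4` applies the one-row case with the
      -- remaining block matrix as its context.
      have e3 := kdet_merge_rows hW hA B (-(p * c)) (-Cs) N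
      have e4 := kdet_fromBlocks_of_row hext (c := c) (A := A) (B := fromCols 0 B)
        (Z := fromCols 0 Z) (d := fromCols 0 d) hA
        (by rw [mul_fromCols, Matrix.mul_zero, hZ]; ext i (j | j) <;> simp)
        (by
          rw [mul_fromCols, Matrix.mul_zero]
          have : c.map h * Z = d.map h := by
            ext i j
            exact congrFun (congrFun hD a) j
          rw [this]; ext i (j | j) <;> simp)
        (fromBlocks A B (-Cs) N) (fromRows 0 p)
      have e5 : -(fromRows (0 : Matrix n Unit R) p * c) = fromRows 0 (-(p * c)) := by
        rw [fromRows_mul, Matrix.zero_mul]; ext (i | i) j <;> simp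
      have e6 : fromBlocks A B (-Cs) N + fromRows 0 p * fromCols 0 d =
          fromBlocks A B (-Cs) (N + p * d) := by
        rw [fromRows_mul, Matrix.zero_mul, mul_fromCols, Matrix.mul_zero]
        ext (i | i) (j | j) <;> simp
      rw [e5, e3, e6, ih] at e4
      rw [e1, e2, neg_add, mul_left_cancel₀ hA e4, add_assoc]
  have e := key Finset.univ N
  simp only [Finset.mem_univ, if_true] at e
  exact e

/-- The class of a block matrix with lower right block `0`, relative to the upper left block,
depends only on the Schur complement. -/
theorem kdet_fromBlocks_eq_of_mul_eq {k : Type} [Fintype k] [DecidableEq k]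
    {A : Matrix n n R} {B : Matrix n m R} {C : Matrix m n R} {A' : Matrix k k R}
    {B' : Matrix k m R} {C' : Matrix m k R} (hA : kdet W A ≠ 0) (hA' : kdet W A' ≠ 0)
    {Z : Matrix n m T} (hZ : A.map h * Z = B.map h) {Z' : Matrix k m T}
    (hZ' : A'.map h * Z' = B'.map h) (hZZ' : C.map h * Z = C'.map h * Z') (N : Matrix m m R) :
    kdet W (fromBlocks A B (-C) N) * kdet W A' = kdet W (fromBlocks A' B' (-C') N) * kdet W A := by
  -- The difference C A⁻¹ B - C' A'⁻¹ B' is a fraction over diag(A, A') equal to 0, taken in the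
  -- context (A' B'; -C' N). In `e2` the two copies of `A'` merge and their lower rows `C'`, `-C'`
  -- cancel, leaving (A B; -C N).
  have e1 := kdet_fromBlocks_of_mul_eq hext (A := fromBlocks A 0 0 A')
    (B := fromBlocks 0 B 0 B') (C := fromBlocks 0 0 C (-C'))
    (D := (0 : Matrix (k ⊕ m) (k ⊕ m) R))
    (Z := fromBlocks 0 Z 0 Z') (LocRow.fromBlocks_ne_zero hW hA hA')
    (by
      simp only [fromBlocks_map, fromBlocks_multiply, hZ, hZ']
      ext (i | i) (j | j) <;> simp)
    (by
      simp only [fromBlocks_map, fromBlocks_multiply, hZZ']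
      ext (i | i) (j | j) <;> simp [Matrix.mul_apply])
    (fromBlocks A' B' (-C') N)
  have e2 := kdet_merge_rows hW hA' (fromCols 0 B') (fromRows 0 C') (fromRows 0 (-C'))
    (fromBlocks A B (-C) N)
  have e3 : fromRows (0 : Matrix n k R) C' + fromRows 0 (-C') = 0 := by
    ext (i | i) j <;> simp
  let g : k ⊕ (k ⊕ (n ⊕ m)) ≃ (n ⊕ k) ⊕ (k ⊕ m) :=
    { toFun := Sum.elim (fun x => .inl (.inr x)) (Sum.elim (fun x => .inr (.inl x))
        (Sum.elim (fun x => .inl (.inl x)) (fun x => .inr (.inr x))))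
      invFun := Sum.elim (Sum.elim (fun x => .inr (.inr (.inl x))) .inl)
        (Sum.elim (fun x => .inr (.inl x)) (fun x => .inr (.inr (.inr x))))
      left_inv := by rintro (x | x | x | x) <;> rfl
      right_inv := by rintro ((x | x) | (x | x)) <;> rfl }
  rw [e3, kdet_fromBlocks_upper hW (Or.inl hA')] at e2
  rw [← kdet_submatrix_equiv hW g, kdet_fromBlocks_upper hW (Or.inl hA), add_zero] at e1
  have e4 : (fromBlocks (fromBlocks A 0 0 A') (fromBlocks 0 B 0 B') (-fromBlocks 0 0 C (-C'))
      (fromBlocks A' B' (-C') N)).submatrix g g = fromBlocks A' (fromCols 0 (fromCols 0 B'))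
        (fromRows 0 (fromRows 0 C')) (fromBlocks A' (fromCols 0 B') (fromRows 0 (-C'))
          (fromBlocks A B (-C) N)) := by
    ext (i | i | i | i) (j | j | j | j) <;> simp [g]
  rw [e4, e2] at e1
  refine mul_left_cancel₀ hA' ?_
  calc _ = kdet W A' * (kdet W A' * kdet W (fromBlocks A B (-C) N)) := by ac_rfl
    _ = _ := by rw [e1]; ac_rfl

end Universal

/-! ### Matrix fractions -/

section Represents

variable {R : Type u} [Ring R] {T : Type u} [Ring T] {W : FGProjEnd R → Prop} {h : R →+* T}
variable {k l m n n' : Type} [Fintype k] [Fintype l] [Fintype m] [Fintype n] [Fintype n']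
  [DecidableEq k] [DecidableEq l] [DecidableEq m] [DecidableEq n] [DecidableEq n']

variable (W h) in
/-- `V = C A⁻¹ B` over `T`, where `A` becomes invertible. -/
structure Represents {l m n : Type} [Fintype n] (C : Matrix m n R) (A : Matrix n n R)
    (B : Matrix n l R) (V : Matrix m l T) : Prop where
  ne_zero : kdet W A ≠ 0
  exists_mul_eq : ∃ Z : Matrix n l T, A.map h * Z = B.map h ∧ C.map h * Z = V

variable (W h) in
/-- `V = C A⁻¹ B` for some matrices `C`, `A`, `B` over `R`, where `A` becomes invertible. -/
def Representable {l m : Type} (V : Matrix m l T) : Prop :=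
  ∃ (n : ℕ) (C : Matrix m (Fin n) R) (A : Matrix (Fin n) (Fin n) R) (B : Matrix (Fin n) l R),
    Represents W h C A B V

variable (hW : DetectsUnits W h)
include hW

omit [Fintype l] [Fintype m] [DecidableEq l] [DecidableEq m] in
theorem Represents.representable {C : Matrix m n R} {A : Matrix n n R} {B : Matrix n l R}
    {V : Matrix m l T} (hV : Represents W h C A B V) : Representable W h V := by
  obtain ⟨hA, Z, h1, h2⟩ := hV
  let e := (Fintype.equivFin n).symm
  refine ⟨Fintype.card n, C.submatrix id e, A.submatrix e e, B.submatrix e id,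
    by rwa [kdet_submatrix_equiv hW], Z.submatrix e id, ?_, ?_⟩
  · rw [← submatrix_map, submatrix_mul_equiv, h1, submatrix_map]
  · rw [← submatrix_map, submatrix_mul_equiv, h2, submatrix_id_id]

omit [Fintype l] [Fintype m] [DecidableEq l] [DecidableEq m] in
theorem Represents.add {C : Matrix m n R} {A : Matrix n n R} {B : Matrix n l R}
    {V : Matrix m l T} {C' : Matrix m n' R} {A' : Matrix n' n' R} {B' : Matrix n' l R}
    {V' : Matrix m l T} (hV : Represents W h C A B V) (hV' : Represents W h C' A' B' V') :
    Represents W h (fromCols C C') (fromBlocks A 0 0 A') (fromRows B B') (V + V') := by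
  obtain ⟨hA, Z, h1, h2⟩ := hV
  obtain ⟨hA', Z', h1', h2'⟩ := hV'
  refine ⟨LocRow.fromBlocks_ne_zero hW hA hA', fromRows Z Z', ?_, ?_⟩
  · rw [fromBlocks_map, fromBlocks_mul_fromRows, h1, h1']
    ext (i | i) j <;> simp
  · have : (fromCols C C').map h = fromCols (C.map h) (C'.map h) := by ext i (j | j) <;> rfl
    rw [this, fromCols_mul_fromRows, h2, h2']

omit [Fintype l] [Fintype m] [DecidableEq l] [DecidableEq k] [DecidableEq m] in
-- The upper right block of (A -BC'; 0 A')⁻¹ is A⁻¹ B C' A'⁻¹.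
theorem Represents.mul {C : Matrix m n R} {A : Matrix n n R} {B : Matrix n k R}
    {V : Matrix m k T} {C' : Matrix k n' R} {A' : Matrix n' n' R} {B' : Matrix n' l R}
    {V' : Matrix k l T} (hV : Represents W h C A B V) (hV' : Represents W h C' A' B' V') :
    Represents W h (fromCols C 0) (fromBlocks A (-(B * C')) 0 A') (fromRows 0 B') (V * V') := by
  obtain ⟨hA, Z, h1, h2⟩ := hV
  obtain ⟨hA', Z', h1', h2'⟩ := hV'
  refine ⟨LocRow.fromBlocks_ne_zero hW hA hA', fromRows (Z * V') Z', ?_, ?_⟩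
  · have : (-(B * C')).map h = -(B.map h * C'.map h) := by
      rw [← Matrix.map_mul]; ext; exact _root_.map_neg h _
    rw [fromBlocks_map, fromBlocks_mul_fromRows, ← Matrix.mul_assoc, h1, h1', this, Matrix.neg_mul,
      Matrix.mul_assoc, h2']
    ext (i | i) j <;> simp
  · have : (fromCols C (0 : Matrix m n' R)).map h = fromCols (C.map h) 0 := by
      ext i (j | j) <;> simp
    rw [this, fromCols_mul_fromRows, ← Matrix.mul_assoc, h2, Matrix.zero_mul, add_zero]

omit [Fintype m] [DecidableEq m] in
theorem represents_map (D : Matrix m l R) : Represents W h D 1 (1 : Matrix l l R) (D.map h) := by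
  refine ⟨by rw [kdet_one hW]; exact one_ne_zero, 1, ?_, ?_⟩
  · rw [Matrix.mul_one]
  · rw [Matrix.mul_one]

omit hW in
theorem represents_inv {A : Matrix n n R} (hA : kdet W A ≠ 0) {Z : Matrix n n T}
    (hZ : A.map h * Z = 1) : Represents W h 1 A 1 Z :=
  ⟨hA, Z, by rw [hZ, Matrix.map_one _ h.map_zero h.map_one], by
    rw [Matrix.map_one _ h.map_zero h.map_one, Matrix.one_mul]⟩

/-- Schur complement factorization over `T`: (A B; -C 0) = (A 0; -C V)(1 Z; 0 1). -/
theorem Represents.kdet_ne_zero {C : Matrix m n R} {A : Matrix n n R} {B : Matrix n m R}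
    {V : Matrix m m T} (hV : Represents W h C A B V) (hu : IsUnit V) :
    kdet W (fromBlocks A B (-C) 0) ≠ 0 := by
  obtain ⟨hA, Z, h1, h2⟩ := hV
  rw [kdet_ne_zero_iff_isUnit hW] at hA ⊢
  have e : (fromBlocks A B (-C) 0).map h =
      fromBlocks (A.map h) 0 (-(C.map h)) V * fromBlocks 1 Z 0 1 := by
    rw [fromBlocks_multiply, fromBlocks_map]
    simp only [Matrix.mul_one, Matrix.mul_zero, add_zero, Matrix.neg_mul, h1, h2]
    ext (i | i) (j | j) <;> simp
  rw [e]
  refine IsUnit.mul ?_ (isUnit_fromBlocks_one_left Z)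
  rw [← isUnit_submatrix_equiv_ring (Equiv.sumComm m n)]
  change IsUnit (Matrix.submatrix _ Sum.swap Sum.swap)
  rw [fromBlocks_submatrix_sum_swap_sum_swap, isUnit_fromBlocks_upper (Or.inl hu)]
  exact ⟨hu, hA⟩

/-- Couple the two block matrices by a block `-1` below the diagonal (`s0`). Eliminating `B` against
it creates -BC' (`s1`); the column operations `s2`, `s3`, `s4` clear `C'`, move `B'` to the other
copy of `m`, and split off an identity block. -/
theorem kdet_fromBlocks_mul {C : Matrix m n R} {A : Matrix n n R} {B : Matrix n m R}
    {C' : Matrix m n' R} {A' : Matrix n' n' R} {B' : Matrix n' m R}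
    (hA : kdet W (fromBlocks A B (-C) 0) ≠ 0) :
    kdet W (fromBlocks (fromBlocks A (-(B * C')) 0 A') (fromRows 0 B') (-(fromCols C 0)) 0) =
      kdet W (fromBlocks A B (-C) 0) * kdet W (fromBlocks A' B' (-C') 0) := by
  let g : (n ⊕ m) ⊕ (n' ⊕ m) ≃ ((n ⊕ n') ⊕ m) ⊕ m :=
    { toFun := Sum.elim (Sum.elim (fun x => .inl (.inl (.inl x))) (fun x => .inl (.inr x)))
        (Sum.elim (fun x => .inl (.inl (.inr x))) .inr)
      invFun := Sum.elim (Sum.elim (Sum.elim (fun x => .inl (.inl x)) (fun x => .inr (.inl x)))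
        (fun x => .inl (.inr x))) (fun x => .inr (.inr x))
      left_inv := by rintro ((x | x) | (x | x)) <;> rfl
      right_inv := by rintro (((x | x) | x) | x) <;> rfl }
  have h1 : kdet W (1 : Matrix m m R) ≠ 0 := by rw [kdet_one hW]; exact one_ne_zero
  have s0 := kdet_fromBlocks_lower hW (C := fromBlocks 0 0 0 (-1))
    (D := fromBlocks A' B' (-C') 0) (Or.inl hA)
  have s1 := kdet_fromBlocks_add_row_upper hW (fromBlocks A B (-C) 0) 0 (fromBlocks 0 0 0 (-1))
    (fromBlocks A' B' (-C') 0) (fromBlocks 0 B 0 0)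
  have s2 := kdet_fromBlocks_add_col_right hW (fromBlocks A 0 (-C) 0) (fromBlocks (-(B * C')) 0 0 0)
    (fromBlocks 0 0 0 (-1)) (fromBlocks A' B' (-C') 0) (fromBlocks 0 0 (-C') (-1))
  have s3 := kdet_fromBlocks_add_col_left hW (fromBlocks A 0 (-C) 0) (fromBlocks (-(B * C')) 0 0 0)
    (fromBlocks 0 0 0 (-1)) (fromBlocks A' B' 0 1) (fromBlocks 0 0 0 1)
  have s4 := kdet_fromBlocks_add_col_right hW (fromBlocks A 0 (-C) 0) (fromBlocks (-(B * C')) 0 0 0)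
    (fromBlocks 0 B' 0 0) (fromBlocks A' B' 0 1) (fromBlocks 0 0 0 (-1))
  simp only [fromBlocks_multiply, fromBlocks_add, Matrix.mul_zero, Matrix.zero_mul, add_zero,
    zero_add, Matrix.mul_neg, Matrix.neg_mul, Matrix.mul_one, Matrix.one_mul, neg_neg, neg_zero,
    add_neg_cancel, neg_add_cancel] at s1 s2 s3 s4
  rw [← s0, ← s1, ← s2, ← s3, ← s4,
    ← mul_one (kdet W (fromBlocks _ (fromRows 0 B') _ _)), ← kdet_one hW (n := m),
    ← kdet_fromBlocks_upper hW (B := 0) (Or.inr h1), ← kdet_submatrix_equiv hW g]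
  congr 1
  ext ((i | i) | (i | i)) ((j | j) | (j | j)) <;> simp [g]

end Represents

/-! ### Extending the class function to the localization -/

section KDetExt

variable {R : Type u} [Ring R] {T : Type u} [Ring T] {W : FGProjEnd R → Prop} {h : R →+* T}
variable {l m n : Type} [Fintype l] [Fintype m] [Fintype n]
  [DecidableEq l] [DecidableEq m] [DecidableEq n]
variable (hW : DetectsUnits W h)
variable (hext : ∀ (l : Type) [Fintype l], ∃ g : T →+* AddMonoid.End (LocRow hW l),
  ExtendsAction hW l g)
variable (hrep : ∀ {l m : Type} [Fintype l] [Fintype m] [DecidableEq l] [DecidableEq m]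
  (V : Matrix m l T), Representable W h V)

/-- The class `[A B; -C 0] / [A]` of the matrix `C A⁻¹ B` over the localization. -/
def kdetExt (V : Matrix m m T) : WithZero (Multiplicative (K1Presented W)) :=
  let n := (hrep V).choose
  let C : Matrix m (Fin n) R := (hrep V).choose_spec.choose
  let A : Matrix (Fin n) (Fin n) R := (hrep V).choose_spec.choose_spec.choose
  let B : Matrix (Fin n) m R := (hrep V).choose_spec.choose_spec.choose_spec.choose
  kdet W (fromBlocks A B (-C) 0) / kdet W A

include hext

theorem kdetExt_eq {C : Matrix m n R} {A : Matrix n n R} {B : Matrix n m R} {V : Matrix m m T}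
    (hV : Represents W h C A B V) :
    kdetExt hrep V = kdet W (fromBlocks A B (-C) 0) / kdet W A := by
  have hc := (hrep V).choose_spec.choose_spec.choose_spec.choose_spec
  obtain ⟨hA, Z, h1, h2⟩ := hc
  obtain ⟨hA', Z', h1', h2'⟩ := hV
  rw [kdetExt, div_eq_div_iff hA hA']
  exact kdet_fromBlocks_eq_of_mul_eq hext hA hA' h1 h1' (h2.trans h2'.symm) 0

theorem kdetExt_map (D : Matrix m m R) : kdetExt hrep (D.map h) = kdet W D := by
  obtain ⟨hA, Z, h1, h2⟩ := represents_map hW D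
  rw [kdetExt_eq hW hext hrep (represents_map hW D), kdet_fromBlocks_of_mul_eq hext hA h1 h2,
    zero_add, mul_div_cancel_left₀ _ hA]

theorem kdetExt_ne_zero {V : Matrix m m T} (hV : IsUnit V) : kdetExt hrep V ≠ 0 := by
  obtain ⟨n, C, A, B, hr⟩ := hrep V
  rw [kdetExt_eq hW hext hrep hr]
  exact div_ne_zero (hr.kdet_ne_zero hW hV) hr.ne_zero

theorem kdetExt_mul {V V' : Matrix m m T} (hV : IsUnit V) :
    kdetExt hrep (V * V') = kdetExt hrep V * kdetExt hrep V' := by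
  obtain ⟨n, C, A, B, hr⟩ := hrep V
  obtain ⟨n', C', A', B', hr'⟩ := hrep V'
  rw [kdetExt_eq hW hext hrep hr, kdetExt_eq hW hext hrep hr',
    kdetExt_eq hW hext hrep (hr.mul hW hr'), kdet_fromBlocks_mul hW (hr.kdet_ne_zero hW hV),
    kdet_fromBlocks_upper hW (Or.inl hr.ne_zero), mul_div_mul_comm]

/-- Represent the block matrix over diag(A₁, A₃, A₂), where A₃ is the denominator of `Y`. After
reordering, the associated matrix is block lower triangular with diagonal (A₁ B₁; -C₁ 0), A₃, (A₂
B₂; -C₂ 0), so A₃ cancels and `Y` has no effect. -/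
theorem kdetExt_fromBlocks_lower {V : Matrix l l T} {Y : Matrix m l T} {V' : Matrix m m T}
    (hV : IsUnit V) :
    kdetExt hrep (fromBlocks V 0 Y V') = kdetExt hrep V * kdetExt hrep V' := by
  obtain ⟨n₁, C₁, A₁, B₁, hr₁⟩ := hrep V
  obtain ⟨n₂, C₂, A₂, B₂, hr₂⟩ := hrep V'
  obtain ⟨n₃, C₃, A₃, B₃, hr₃⟩ := hrep Y
  have hM := hr₁.kdet_ne_zero hW hV
  rw [kdetExt_eq hW hext hrep hr₁, kdetExt_eq hW hext hrep hr₂]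
  obtain ⟨hA₁, Z₁, e₁, f₁⟩ := hr₁
  obtain ⟨hA₂, Z₂, e₂, f₂⟩ := hr₂
  obtain ⟨hA₃, Z₃, e₃, f₃⟩ := hr₃
  have hA := LocRow.fromBlocks_ne_zero hW (B := 0) hA₁
    (LocRow.fromBlocks_ne_zero hW (B := 0) hA₃ hA₂)
  have hr : Represents W h (fromBlocks C₁ 0 0 (fromCols C₃ C₂))
      (fromBlocks A₁ 0 0 (fromBlocks A₃ 0 0 A₂)) (fromBlocks B₁ 0 (fromRows B₃ 0) (fromRows 0 B₂))
      (fromBlocks V 0 Y V') := by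
    refine ⟨hA, fromBlocks Z₁ 0 (fromRows Z₃ 0) (fromRows 0 Z₂), ?_, ?_⟩
    · simp only [fromBlocks_map, fromBlocks_multiply, fromBlocks_mul_fromRows, e₁, e₂, e₃]
      ext (i | i | i) (j | j) <;> simp
    · have : (fromCols C₃ C₂).map h = fromCols (C₃.map h) (C₂.map h) := by ext i (j | j) <;> rfl
      simp only [fromBlocks_map, fromBlocks_multiply, this, fromCols_mul_fromRows, f₁, f₂, f₃]
      ext (i | i) (j | j) <;> simp
  rw [kdetExt_eq hW hext hrep hr, kdet_fromBlocks_upper hW (Or.inl hA₁),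
    kdet_fromBlocks_upper hW (Or.inl hA₃)]
  let g : (Fin n₁ ⊕ l) ⊕ (Fin n₃ ⊕ (Fin n₂ ⊕ m)) ≃ (Fin n₁ ⊕ (Fin n₃ ⊕ Fin n₂)) ⊕ (l ⊕ m) :=
    { toFun := Sum.elim (Sum.elim (fun x => .inl (.inl x)) (fun x => .inr (.inl x)))
        (Sum.elim (fun x => .inl (.inr (.inl x)))
          (Sum.elim (fun x => .inl (.inr (.inr x))) (fun x => .inr (.inr x))))
      invFun := Sum.elim (Sum.elim (fun x => .inl (.inl x))
        (Sum.elim (fun x => .inr (.inl x)) (fun x => .inr (.inr (.inl x)))))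
        (Sum.elim (fun x => .inl (.inr x)) (fun x => .inr (.inr (.inr x))))
      left_inv := by rintro ((x | x) | (x | x | x)) <;> rfl
      right_inv := by rintro ((x | x | x) | (x | x)) <;> rfl }
  have e : (fromBlocks (fromBlocks A₁ 0 0 (fromBlocks A₃ 0 0 A₂))
      (fromBlocks B₁ 0 (fromRows B₃ 0) (fromRows 0 B₂))
      (-(fromBlocks C₁ 0 0 (fromCols C₃ C₂))) 0).submatrix g g =
      fromBlocks (fromBlocks A₁ B₁ (-C₁) 0) 0 (fromRows (fromCols 0 B₃) 0)
        (fromBlocks A₃ 0 (fromRows 0 (-C₃)) (fromBlocks A₂ B₂ (-C₂) 0)) := by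
    ext ((i | i) | (i | i | i)) ((j | j) | (j | j | j)) <;> simp [g]
  rw [← kdet_submatrix_equiv hW g, e, kdet_fromBlocks_lower hW (Or.inl hM),
    kdet_fromBlocks_lower hW (Or.inl hA₃), div_mul_div_comm, mul_left_comm, mul_left_comm (kdet W A₁),
    mul_div_mul_left _ _ hA₃]

end KDetExt

/-! ### Matrices of endomorphisms of projective modules -/

section Retract

variable {R : Type*} [Ring R] {P F : Type*} [AddCommGroup P] [Module R P] [AddCommGroup F]
  [Module R F]

/-- For a retract `P` of `F`, the endomorphism of `F = P ⊕ Q` that is `f` on `P` and the identity on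
the complement `Q`. -/
def extendByOne (ι : P →ₗ[R] F) (π : F →ₗ[R] P) (f : P →ₗ[R] P) : F →ₗ[R] F :=
  LinearMap.id - ι ∘ₗ π + ι ∘ₗ f ∘ₗ π

variable {ι : P →ₗ[R] F} {π : F →ₗ[R] P}

theorem extendByOne_apply (f : P →ₗ[R] P) (v : F) :
    extendByOne ι π f v = v - ι (π v) + ι (f (π v)) := rfl

theorem bijective_extendByOne_iff (hιπ : ∀ x, π (ι x) = x) (f : P →ₗ[R] P) :
    Function.Bijective (extendByOne ι π f) ↔ Function.Bijective f := by
  have h1 : ∀ x, extendByOne ι π f (ι x) = ι (f x) := fun x => by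
    simp [extendByOne_apply, hιπ]
  have h2 : ∀ v, π (extendByOne ι π f v) = f (π v) := fun v => by
    simp [extendByOne_apply, hιπ]
  constructor
  · rintro ⟨hi, hs⟩
    refine ⟨fun x y hxy => ?_, fun y => ?_⟩
    · rw [← hιπ x, ← hιπ y, hi ((h1 x).trans ((congrArg ι hxy).trans (h1 y).symm))]
    · obtain ⟨v, hv⟩ := hs (ι y)
      exact ⟨π v, by rw [← h2, hv, hιπ]⟩
  · rintro ⟨hi, hs⟩
    refine ⟨fun v w hvw => ?_, fun w => ?_⟩
    · have e : π v = π w := hi (by rw [← h2, ← h2, hvw])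
      rw [extendByOne_apply, extendByOne_apply, e] at hvw
      simpa using hvw
    · obtain ⟨x, hx⟩ := hs (π w)
      exact ⟨w - ι (π w) + ι x, by simp [extendByOne_apply, hιπ, hx]⟩

theorem extendByOne_comp (hιπ : ∀ x, π (ι x) = x) (g f : P →ₗ[R] P) :
    extendByOne ι π (g ∘ₗ f) = extendByOne ι π g ∘ₗ extendByOne ι π f :=
  LinearMap.ext fun v => by simp [extendByOne_apply, hιπ]

variable {n : Type} [Fintype n] [DecidableEq n]

theorem bijective_vecMulLinear_iff {A : Matrix n n R} :
    Function.Bijective A.vecMulLinear ↔ IsUnit A := by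
  constructor
  · intro hA
    let e := LinearEquiv.ofBijective _ hA
    have hA' : LinearMap.toMatrixRight' A.vecMulLinear = A :=
      LinearMap.toMatrixRight'.apply_symm_apply A
    refine isUnit_iff_exists.2 ⟨LinearMap.toMatrixRight' e.symm.toLinearMap, ?_, ?_⟩
    · conv_lhs => rw [← hA']
      rw [← LinearMap.toMatrixRight'_comp, ← LinearMap.toMatrixRight'_id]
      exact congrArg _ (LinearMap.ext fun x => e.symm_apply_apply x)
    · conv_lhs => rw [← hA']
      rw [← LinearMap.toMatrixRight'_comp, ← LinearMap.toMatrixRight'_id]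
      exact congrArg _ (LinearMap.ext fun x => e.apply_symm_apply x)
  · intro hA
    obtain ⟨B, h1, h2⟩ := isUnit_iff_exists.1 hA
    exact (Matrix.toLinearEquivRight'OfInv h2 h1).bijective

/-- The matrix of the extension by one of an endomorphism of a retract of a free module. -/
def retractMatrix (ι : P →ₗ[R] (n → R)) (π : (n → R) →ₗ[R] P) (f : P →ₗ[R] P) : Matrix n n R :=
  LinearMap.toMatrixRight' (extendByOne ι π f)

theorem vecMulLinear_retractMatrix (ι : P →ₗ[R] (n → R)) (π : (n → R) →ₗ[R] P) (f : P →ₗ[R] P) :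
    (retractMatrix ι π f).vecMulLinear = extendByOne ι π f :=
  LinearMap.toMatrixRight'.symm_apply_apply _

theorem isUnit_retractMatrix_iff {ι : P →ₗ[R] (n → R)} {π : (n → R) →ₗ[R] P}
    (hιπ : ∀ x, π (ι x) = x) (f : P →ₗ[R] P) :
    IsUnit (retractMatrix ι π f) ↔ Function.Bijective f := by
  rw [← bijective_vecMulLinear_iff, vecMulLinear_retractMatrix, bijective_extendByOne_iff hιπ]

theorem retractMatrix_comp {ι : P →ₗ[R] (n → R)} {π : (n → R) →ₗ[R] P} (hιπ : ∀ x, π (ι x) = x)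
    (g f : P →ₗ[R] P) :
    retractMatrix ι π (g ∘ₗ f) = retractMatrix ι π f * retractMatrix ι π g := by
  rw [retractMatrix, extendByOne_comp hιπ, LinearMap.toMatrixRight'_comp]
  rfl

theorem exists_retract (R P : Type*) [Ring R] [AddCommGroup P] [Module R P] [Module.Finite R P]
    [Module.Projective R P] : ∃ (n : ℕ) (ι : P →ₗ[R] (Fin n → R)) (π : (Fin n → R) →ₗ[R] P),
      ∀ x, π (ι x) = x := by
  obtain ⟨n, π, ι, -, -, e⟩ := Module.Finite.exists_comp_eq_id_of_projective R P
  exact ⟨n, ι, π, fun x => LinearMap.congr_fun e x⟩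

end Retract

/-! ### Extension of scalars for free modules and their retracts -/

section BaseChangeFree

variable {R T : Type u} [Ring R] [Ring T] (h : R →+* T)
variable {n : Type} [Fintype n] [DecidableEq n]

/-- Extension of scalars of the module of row vectors. -/
def baseChangeRow (n : Type) [Fintype n] [DecidableEq n] :
    BaseChange h (n → R) ≃ₗ[T] (n → T) :=
  LinearEquiv.ofLinearMap
    (BaseChange.lift h (AddMonoidHom.mk' (fun v j => h (v j)) fun v w => by ext; simp)
      fun r v => by ext; simp)
    (Fintype.linearCombination T fun j => BaseChange.tmul h 1 (Pi.single j (1 : R)))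
    (by
      refine LinearMap.pi_ext' fun j => LinearMap.ext_ring ?_
      ext i
      simp [Fintype.linearCombination_apply_single, BaseChange.lift_tmul, Pi.single_apply,
        apply_ite h])
    (by
      refine BaseChange.hom_ext h fun v => ?_
      simp only [LinearMap.comp_apply, BaseChange.lift_tmul, one_smul, AddMonoidHom.mk'_apply,
        Fintype.linearCombination_apply, LinearMap.id_apply, BaseChange.smul_tmul, mul_one]
      let t : (n → R) →+ BaseChange h (n → R) :=
        AddMonoidHom.mk' (BaseChange.tmul h 1) (BaseChange.tmul_add h 1)
      change _ = t v
      conv_rhs => rw [← Finset.univ_sum_single v, map_sum]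
      refine Finset.sum_congr rfl fun j _ => ?_
      change _ = BaseChange.tmul h 1 _
      have : Pi.single j (v j) = v j • Pi.single (M := fun _ => R) j 1 := by
        rw [← Pi.single_smul', smul_eq_mul, mul_one]
      rw [this, BaseChange.tmul_smul, one_mul])

theorem baseChangeRow_tmul (t : T) (v : n → R) :
    baseChangeRow h n (BaseChange.tmul h t v) = t • fun j => h (v j) :=
  BaseChange.lift_tmul h _ (fun r v => by ext; simp) t v

theorem baseChangeRow_comp_map {m : Type} [Fintype m] [DecidableEq m] (A : Matrix m n R)
    (x : BaseChange h (m → R)) : baseChangeRow h n (BaseChange.map h A.vecMulLinear x) =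
      (A.map h).vecMulLinear (baseChangeRow h m x) := by
  have e : (baseChangeRow h n).toLinearMap ∘ₗ BaseChange.map h A.vecMulLinear =
      (A.map h).vecMulLinear ∘ₗ (baseChangeRow h m).toLinearMap := by
    refine BaseChange.hom_ext h fun v => ?_
    simp only [LinearMap.comp_apply, BaseChange.map_tmul, LinearEquiv.coe_coe, baseChangeRow_tmul,
      one_smul]
    ext j
    simp [Matrix.vecMul, dotProduct]
  exact LinearMap.congr_fun e x

theorem becomesAuto_matEnd_iff (A : Matrix n n R) :
    (matEnd A).BecomesAuto h ↔ IsUnit (A.map h) := by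
  rw [← bijective_vecMulLinear_iff]
  have e : ⇑(BaseChange.map h A.vecMulLinear) =
      (baseChangeRow h n).symm ∘ (A.map h).vecMulLinear ∘ baseChangeRow h n := by
    funext x
    exact ((baseChangeRow h n).eq_symm_apply).2 (baseChangeRow_comp_map h A x)
  change Function.Bijective (BaseChange.map h A.vecMulLinear) ↔ _
  rw [e, EquivLike.comp_bijective, EquivLike.bijective_comp]

variable {P : Type u} [AddCommGroup P] [Module R P]

theorem map_extendByOne {F : Type u} [AddCommGroup F] [Module R F] (ι : P →ₗ[R] F)
    (π : F →ₗ[R] P) (f : P →ₗ[R] P) : BaseChange.map h (extendByOne ι π f) =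
      extendByOne (BaseChange.map h ι) (BaseChange.map h π) (BaseChange.map h f) := by
  have e : extendByOne ι π f + ι ∘ₗ π = LinearMap.id + ι ∘ₗ f ∘ₗ π := by
    rw [extendByOne]; abel
  have e' := congrArg (BaseChange.map h) e
  rw [BaseChange.map_add, BaseChange.map_add, BaseChange.map_id, BaseChange.map_comp,
    BaseChange.map_comp, BaseChange.map_comp] at e'
  rw [eq_sub_of_add_eq e', extendByOne]
  abel

theorem map_retract {F : Type u} [AddCommGroup F] [Module R F] {ι : P →ₗ[R] F}
    {π : F →ₗ[R] P} (hιπ : ∀ x, π (ι x) = x) (x : BaseChange h P) :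
    BaseChange.map h π (BaseChange.map h ι x) = x := by
  have e : π ∘ₗ ι = LinearMap.id := LinearMap.ext hιπ
  rw [← LinearMap.comp_apply, ← BaseChange.map_comp, e, BaseChange.map_id, LinearMap.id_apply]

theorem becomesAuto_iff_isUnit_retractMatrix [Module.Finite R P] [Module.Projective R P]
    {ι : P →ₗ[R] (n → R)} {π : (n → R) →ₗ[R] P}
    (hιπ : ∀ x, π (ι x) = x) (f : P →ₗ[R] P) :
    (⟨P, f⟩ : FGProjEnd R).BecomesAuto h ↔ IsUnit ((retractMatrix ι π f).map h) := by
  rw [← becomesAuto_matEnd_iff]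
  change Function.Bijective (BaseChange.map h f) ↔
    Function.Bijective (BaseChange.map h (retractMatrix ι π f).vecMulLinear)
  rw [vecMulLinear_retractMatrix, map_extendByOne, bijective_extendByOne_iff (map_retract h hιπ)]

theorem retractMatrix_baseChange (ι : P →ₗ[R] (n → R)) (π : (n → R) →ₗ[R] P)
    (f : P →ₗ[R] P) :
    retractMatrix ((baseChangeRow h n).toLinearMap ∘ₗ BaseChange.map h ι)
      (BaseChange.map h π ∘ₗ (baseChangeRow h n).symm.toLinearMap) (BaseChange.map h f) =
      (retractMatrix ι π f).map h := by
  apply LinearMap.toMatrixRight'.symm.injective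
  change (retractMatrix _ _ _).vecMulLinear = ((retractMatrix ι π f).map h).vecMulLinear
  rw [vecMulLinear_retractMatrix]
  refine LinearMap.ext fun v => ?_
  obtain ⟨x, rfl⟩ := (baseChangeRow h n).surjective v
  rw [← baseChangeRow_comp_map, vecMulLinear_retractMatrix, map_extendByOne]
  simp [extendByOne_apply]

theorem detectsUnits_becomesAuto : DetectsUnits (FGProjEnd.BecomesAuto h) h :=
  ⟨fun A => becomesAuto_matEnd_iff h A⟩

theorem detectsUnits_isAuto : DetectsUnits (FGProjEnd.IsAuto (R := R)) (RingHom.id R) :=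
  ⟨fun A => by
    have e : A.map (RingHom.id R) = A := by ext; rfl
    rw [e]
    exact bijective_vecMulLinear_iff⟩

end BaseChangeFree

/-! ### Identities, isomorphisms and retracts in K₁ -/

section Classes

variable {R : Type u} [Ring R] {W : FGProjEnd R → Prop} {T : Type u} [Ring T] {h : R →+* T}
variable {n : Type} [Fintype n] [DecidableEq n]
variable (hid : ∀ (P : Type u) [AddCommGroup P] [Module R P] [Module.Finite R P]
    [Module.Projective R P], W ⟨P, LinearMap.id⟩)
include hid

theorem K1Presented.mk_id (P : Type u) [AddCommGroup P] [Module R P] [Module.Finite R P]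
    [Module.Projective R P] : K1Presented.mk ⟨P, LinearMap.id⟩ (hid P) = 0 := by
  have e := K1Presented.mk_comp P LinearMap.id LinearMap.id (hid P) (hid P) (hid P)
  exact left_eq_add.1 e

theorem K1Presented.mk_eq_of_equiv {x y : FGProjEnd R} (hx : W x) (hy : W y) (e : x.P ≃ₗ[R] y.P)
    (he : ∀ v, e (x.hom v) = y.hom (e v)) : K1Presented.mk x hx = K1Presented.mk y hy := by
  have e := K1Presented.mk_exact x y ⟨PUnit.{u + 1}, LinearMap.id⟩ hx hy (hid _)
    ⟨e.toLinearMap, 0, e.injective, fun v => ⟨fun _ => e.surjective v, fun _ => rfl⟩,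
      fun v => ⟨0, rfl⟩, LinearMap.ext fun v => (he v).symm, LinearMap.ext fun v => rfl⟩
  rw [e, K1Presented.mk_id hid, add_zero]

/-- Apply the exact-sequence relation to 0 → P → Rⁿ → ker π → 0, with `f` on the left and the
identity, of class 0, on the right. -/
theorem kdet_retractMatrix {P : Type u} [AddCommGroup P] [Module R P] [Module.Finite R P]
    [Module.Projective R P] {ι : P →ₗ[R] (n → R)} {π : (n → R) →ₗ[R] P}
    (hιπ : ∀ x, π (ι x) = x) {f : P →ₗ[R] P} (hf : W ⟨P, f⟩)
    (hf' : W (matEnd (retractMatrix ι π f))) :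
    kdet W (retractMatrix ι π f) = ↑(Multiplicative.ofAdd (K1Presented.mk ⟨P, f⟩ hf)) := by
  rw [kdet_of hf']
  congr 2
  let K := LinearMap.ker π
  let q : (n → R) →ₗ[R] K := LinearMap.codRestrict K (LinearMap.id - ι ∘ₗ π) fun v => by
    simp [K, hιπ]
  have hq : q ∘ₗ K.subtype = LinearMap.id := LinearMap.ext fun v => Subtype.ext <| by
    have : π v = 0 := v.2
    simp [q, this]
  have : Module.Finite R K := Module.Finite.of_surjective q fun v =>
    ⟨v, LinearMap.congr_fun hq v⟩
  have : Module.Projective R K := Module.Projective.of_split K.subtype q hq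
  have hex : Function.Exact ι q := by
    intro v
    constructor
    · intro hv
      have : v - ι (π v) = 0 := congrArg Subtype.val hv
      exact ⟨π v, (sub_eq_zero.1 this).symm⟩
    · rintro ⟨x, rfl⟩
      exact Subtype.ext (by simp [q, hιπ])
  have e := K1Presented.mk_exact ⟨P, f⟩ (matEnd (retractMatrix ι π f)) ⟨K, LinearMap.id⟩ hf hf'
    (hid K) ⟨ι, q, ?_, ?_, ?_, ?_, ?_⟩
  · rw [e, K1Presented.mk_id hid, add_zero]
  · exact Function.LeftInverse.injective hιπ
  · exact hex
  · exact fun v => ⟨v.1, LinearMap.congr_fun hq v⟩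
  · change (retractMatrix ι π f).vecMulLinear ∘ₗ ι = ι ∘ₗ f
    rw [vecMulLinear_retractMatrix]
    exact LinearMap.ext fun v => by simp [extendByOne_apply, hιπ]
  · change LinearMap.id ∘ₗ q = q ∘ₗ (retractMatrix ι π f).vecMulLinear
    rw [vecMulLinear_retractMatrix]
    exact LinearMap.ext fun v => Subtype.ext (by simp [q, extendByOne_apply, hιπ])

end Classes

/-! ### Homomorphisms out of `K₁` given by functions on invertible matrices -/

section LiftDet

variable {S : Type u} [Ring S] {Γ : Type*} [CommGroupWithZero Γ]

/-- A multiplicative function on invertible matrices that is multiplicative on block triangular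
matrices. -/
structure IsDetLike (D : ∀ (n : Type) [Fintype n] [DecidableEq n], Matrix n n S → Γ) : Prop where
  ne_zero : ∀ {n : Type} [Fintype n] [DecidableEq n] {A : Matrix n n S}, IsUnit A → D n A ≠ 0
  mul : ∀ {n : Type} [Fintype n] [DecidableEq n] {A B : Matrix n n S}, IsUnit A → IsUnit B →
    D n (A * B) = D n A * D n B
  fromBlocks_lower : ∀ {m n : Type} [Fintype m] [DecidableEq m] [Fintype n] [DecidableEq n]
    {A : Matrix m m S} {C : Matrix n m S} {B : Matrix n n S}, IsUnit A → IsUnit B →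
    D (m ⊕ n) (fromBlocks A 0 C B) = D m A * D n B

variable {D : ∀ (n : Type) [Fintype n] [DecidableEq n], Matrix n n S → Γ} (hD : IsDetLike D)
variable {m n : Type} [Fintype m] [Fintype n] [DecidableEq m] [DecidableEq n]

include hD in
theorem IsDetLike.one : D n 1 = 1 := by
  have e := hD.mul (n := n) isUnit_one isUnit_one
  rw [mul_one] at e
  exact (mul_eq_left₀ (hD.ne_zero isUnit_one)).1 e.symm

variable {P : Type*} [AddCommGroup P] [Module S P]

include hD in
-- The two completions are stably conjugate: in Sⁿ ⊕ Sᵐ = (P ⊕ Q) ⊕ (P ⊕ Q') the involution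
-- exchanging the two copies of P conjugates diag(M, 1) to diag(1, M').
theorem IsDetLike.retractMatrix_eq {ι : P →ₗ[S] (n → S)} {π : (n → S) →ₗ[S] P}
    (hιπ : ∀ x, π (ι x) = x) {ι' : P →ₗ[S] (m → S)} {π' : (m → S) →ₗ[S] P}
    (hιπ' : ∀ x, π' (ι' x) = x) {f : P →ₗ[S] P} (hf : Function.Bijective f) :
    D n (retractMatrix ι π f) = D m (retractMatrix ι' π' f) := by
  have hu := (isUnit_retractMatrix_iff hιπ f).2 hf
  have hu' := (isUnit_retractMatrix_iff hιπ' f).2 hf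
  let b : Matrix n m S := LinearMap.toMatrixRight' (ι' ∘ₗ π)
  let c : Matrix m n S := LinearMap.toMatrixRight' (ι ∘ₗ π')
  have e1 : b * c = LinearMap.toMatrixRight' (ι ∘ₗ π) := by
    rw [← LinearMap.toMatrixRight'_comp]
    exact congrArg _ (LinearMap.ext fun v => by simp [hιπ'])
  have e2 : c * b = LinearMap.toMatrixRight' (ι' ∘ₗ π') := by
    rw [← LinearMap.toMatrixRight'_comp]
    exact congrArg _ (LinearMap.ext fun v => by simp [hιπ])
  have e3 : b * c * b = b := by
    rw [e1, ← LinearMap.toMatrixRight'_comp]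
    exact congrArg _ (LinearMap.ext fun v => by simp [hιπ])
  have e4 : c * b * c = c := by
    rw [e2, ← LinearMap.toMatrixRight'_comp]
    exact congrArg _ (LinearMap.ext fun v => by simp [hιπ'])
  have e5 : retractMatrix ι π f = 1 - b * c + LinearMap.toMatrixRight' (ι ∘ₗ f ∘ₗ π) := by
    rw [retractMatrix, extendByOne, map_add, map_sub, LinearMap.toMatrixRight'_id, e1]
  have e6 : retractMatrix ι' π' f = 1 - c * b + LinearMap.toMatrixRight' (ι' ∘ₗ f ∘ₗ π') := by
    rw [retractMatrix, extendByOne, map_add, map_sub, LinearMap.toMatrixRight'_id, e2]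
  have e7 : LinearMap.toMatrixRight' (ι ∘ₗ f ∘ₗ π) * b =
      b * LinearMap.toMatrixRight' (ι' ∘ₗ f ∘ₗ π') := by
    rw [← LinearMap.toMatrixRight'_comp, ← LinearMap.toMatrixRight'_comp]
    exact congrArg _ (LinearMap.ext fun v => by simp [hιπ, hιπ'])
  have e8 : LinearMap.toMatrixRight' (ι ∘ₗ f ∘ₗ π) * (b * c) =
      LinearMap.toMatrixRight' (ι ∘ₗ f ∘ₗ π) := by
    rw [e1, ← LinearMap.toMatrixRight'_comp]
    exact congrArg _ (LinearMap.ext fun v => by simp [hιπ])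
  have e9 : c * b * LinearMap.toMatrixRight' (ι' ∘ₗ f ∘ₗ π') =
      LinearMap.toMatrixRight' (ι' ∘ₗ f ∘ₗ π') := by
    rw [e2, ← LinearMap.toMatrixRight'_comp]
    exact congrArg _ (LinearMap.ext fun v => by simp [hιπ'])
  generalize LinearMap.toMatrixRight' (ι ∘ₗ f ∘ₗ π) = a at *
  generalize LinearMap.toMatrixRight' (ι' ∘ₗ f ∘ₗ π') = a' at *
  have e10 : b * c * (b * c) = b * c := by rw [← Matrix.mul_assoc, e3]
  have e11 : c * b * (c * b) = c * b := by rw [← Matrix.mul_assoc, e4]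
  -- The exchange involution: `b` and `c` identify the copies of P, while `1 - b * c` and `1 - c *
  -- b` project onto the complements.
  have hU2 : fromBlocks (1 - b * c) b c (1 - c * b) * fromBlocks (1 - b * c) b c (1 - c * b) =
      1 := by
    rw [fromBlocks_multiply, ← fromBlocks_one]
    congr 1
    · simp only [Matrix.sub_mul, Matrix.mul_sub, Matrix.one_mul, Matrix.mul_one, e10]; abel
    · simp only [Matrix.sub_mul, Matrix.mul_sub, Matrix.one_mul, Matrix.mul_one, e3,
        ← Matrix.mul_assoc]; abel
    · simp only [Matrix.sub_mul, Matrix.mul_sub, Matrix.one_mul, Matrix.mul_one, e4,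
        ← Matrix.mul_assoc]; abel
    · simp only [Matrix.sub_mul, Matrix.mul_sub, Matrix.one_mul, Matrix.mul_one, e11]; abel
  have hU : IsUnit (fromBlocks (1 - b * c) b c (1 - c * b)) := isUnit_iff_exists.2 ⟨_, hU2, hU2⟩
  have hconj : fromBlocks (retractMatrix ι π f) 0 0 1 * fromBlocks (1 - b * c) b c (1 - c * b) =
      fromBlocks (1 - b * c) b c (1 - c * b) * fromBlocks 1 0 0 (retractMatrix ι' π' f) := by
    rw [fromBlocks_multiply, fromBlocks_multiply, e5, e6]
    simp only [Matrix.sub_mul, Matrix.mul_sub, Matrix.add_mul, Matrix.mul_add, Matrix.one_mul,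
      Matrix.mul_one, Matrix.zero_mul, Matrix.mul_zero, add_zero, zero_add, e10, e11, e8, e9, e7, e3,
      ← Matrix.mul_assoc b c b]
    congr 1
    all_goals abel
  have h1 := hD.mul (isUnit_fromBlocks_diagonal.2 ⟨hu, isUnit_one⟩) hU
  rw [hconj, hD.mul hU (isUnit_fromBlocks_diagonal.2 ⟨isUnit_one, hu'⟩),
    hD.fromBlocks_lower isUnit_one hu', hD.fromBlocks_lower hu isUnit_one, hD.one, hD.one, one_mul,
    mul_one, mul_comm] at h1
  exact (mul_right_cancel₀ (hD.ne_zero hU) h1).symm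

/-- A splitting P₁ = P₀ ⊕ P₂ adds up the two given retracts. Since f₁ preserves P₀ and matrices act
on rows, the matrix is block lower triangular; `Y` is the component of f₁ from P₂ to P₀. -/
theorem exists_retractMatrix_eq_fromBlocks {P₀ P₁ P₂ : Type*} [AddCommGroup P₀] [AddCommGroup P₁]
    [AddCommGroup P₂] [Module S P₀] [Module S P₁] [Module S P₂] [Module.Projective S P₂]
    {j : P₀ →ₗ[S] P₁} {q : P₁ →ₗ[S] P₂} (hj : Function.Injective j) (hjq : Function.Exact j q)
    (hq : Function.Surjective q) {f₀ : P₀ →ₗ[S] P₀} {f₁ : P₁ →ₗ[S] P₁} {f₂ : P₂ →ₗ[S] P₂}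
    (h₀ : f₁ ∘ₗ j = j ∘ₗ f₀) (h₂ : f₂ ∘ₗ q = q ∘ₗ f₁)
    {ι : P₀ →ₗ[S] (m → S)} {π : (m → S) →ₗ[S] P₀} (hιπ : ∀ x, π (ι x) = x)
    {ι' : P₂ →ₗ[S] (n → S)} {π' : (n → S) →ₗ[S] P₂} (hιπ' : ∀ x, π' (ι' x) = x) :
    ∃ (ι₁ : P₁ →ₗ[S] (m ⊕ n → S)) (π₁ : (m ⊕ n → S) →ₗ[S] P₁) (Y : Matrix n m S),
      (∀ x, π₁ (ι₁ x) = x) ∧ retractMatrix ι₁ π₁ f₁ =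
        fromBlocks (retractMatrix ι π f₀) 0 Y (retractMatrix ι' π' f₂) := by
  obtain ⟨t, ht⟩ := Module.projective_lifting_property q LinearMap.id hq
  have hqt : ∀ x, q (t x) = x := LinearMap.congr_fun ht
  have hqj : ∀ x, q (j x) = 0 := fun x => (hjq _).2 ⟨x, rfl⟩
  have hr : ∀ x, ∃ y, j y = x - t (q x) := fun x => (hjq _).1 (by rw [map_sub, hqt, sub_self])
  choose r hr using hr
  let r' : P₁ →ₗ[S] P₀ :=
    { toFun := r
      map_add' := fun x y => hj (by rw [map_add, hr, hr, hr, map_add, map_add]; abel)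
      map_smul' := fun c x => hj (by simp [hr, smul_sub]) }
  have hr' : ∀ x, j (r' x) = x - t (q x) := hr
  have hrj : ∀ x, r' (j x) = x := fun x => hj (by rw [hr', hqj, map_zero, sub_zero])
  have hrt : ∀ x, r' (t x) = 0 := fun x => hj (by rw [hr', hqt, sub_self, map_zero])
  have hf₀ : ∀ x, f₁ (j x) = j (f₀ x) := LinearMap.congr_fun h₀
  have hf₂ : ∀ x, f₂ (q x) = q (f₁ x) := LinearMap.congr_fun h₂
  let ι₁ : P₁ →ₗ[S] (m ⊕ n → S) :=
    { toFun := fun v => Sum.elim (ι (r' v)) (ι' (q v))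
      map_add' := fun v w => by funext x; rcases x with x | x <;> simp
      map_smul' := fun c w => by funext x; rcases x with x | x <;> simp }
  let π₁ : (m ⊕ n → S) →ₗ[S] P₁ := j ∘ₗ π ∘ₗ LinearMap.funLeft S S Sum.inl +
    t ∘ₗ π' ∘ₗ LinearMap.funLeft S S Sum.inr
  have hπ₁ : ∀ w, π₁ w = j (π (w ∘ Sum.inl)) + t (π' (w ∘ Sum.inr)) := fun w => rfl
  have hι₁ : ∀ v, ι₁ v = Sum.elim (ι (r' v)) (ι' (q v)) := fun w => rfl
  refine ⟨ι₁, π₁, LinearMap.toMatrixRight' (ι ∘ₗ r' ∘ₗ f₁ ∘ₗ t ∘ₗ π'), fun x => ?_, ?_⟩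
  · rw [hπ₁, hι₁]
    simp [hιπ, hιπ', hr']
  · apply LinearMap.toMatrixRight'.symm.injective
    change (retractMatrix _ _ _).vecMulLinear = (fromBlocks _ _ _ _).vecMulLinear
    refine LinearMap.ext fun w => ?_
    rw [vecMulLinear_retractMatrix, extendByOne_apply, vecMulLinear_apply,
      Matrix.vecMul_fromBlocks, ← vecMulLinear_apply (retractMatrix ι π f₀),
      ← vecMulLinear_apply (retractMatrix ι' π' f₂), ← vecMulLinear_apply (LinearMap.toMatrixRight' _), vecMulLinear_retractMatrix,
      vecMulLinear_retractMatrix, extendByOne_apply, extendByOne_apply]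
    have hY : (LinearMap.toMatrixRight' (ι ∘ₗ r' ∘ₗ f₁ ∘ₗ t ∘ₗ π')).vecMulLinear =
        ι ∘ₗ r' ∘ₗ f₁ ∘ₗ t ∘ₗ π' := LinearMap.toMatrixRight'.symm_apply_apply _
    rw [hY, hπ₁, hι₁, hι₁]
    funext x
    rcases x with x | x
    · simp [hrj, hrt, hf₀, add_assoc]
    · simp [hqj, hqt, ← hf₂]

/-- A determinant-like function on invertible matrices induces a homomorphism on `K₁`. -/
theorem IsDetLike.exists_hom (hD : IsDetLike D) : ∃ φ : K1 S →+ Additive Γˣ,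
    ∀ (x : FGProjEnd S) (hx : x.IsAuto) (n : Type) [Fintype n] [DecidableEq n]
      (ι : x.P →ₗ[S] (n → S)) (π : (n → S) →ₗ[S] x.P), (∀ v, π (ι v) = v) →
      ((φ (K1Presented.mk x hx)).toMul : Γ) = D n (retractMatrix ι π x.hom) := by
  have hex : ∀ x : {x : FGProjEnd S // x.IsAuto}, ∃ u : Γˣ,
      ∀ (n : Type) [Fintype n] [DecidableEq n]
      (ι : x.1.P →ₗ[S] (n → S)) (π : (n → S) →ₗ[S] x.1.P), (∀ v, π (ι v) = v) →
      (u : Γ) = D n (retractMatrix ι π x.1.hom) := by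
    intro x
    obtain ⟨n, ι, π, hιπ⟩ := exists_retract S x.1.P
    exact ⟨Units.mk0 _ (hD.ne_zero ((isUnit_retractMatrix_iff hιπ _).2 x.2)),
      fun m _ _ ι' π' hιπ' => hD.retractMatrix_eq hιπ hιπ' x.2⟩
  choose u hu using hex
  refine ⟨QuotientAddGroup.lift _ (FreeAbelianGroup.lift fun x => Additive.ofMul (u x)) ?_, ?_⟩
  · rw [AddSubgroup.closure_le]
    rintro _ (⟨P, g, f, hg, hf, hgf⟩ | ⟨x₀, x₁, x₂, hx⟩)
    · simp only [SetLike.mem_coe, AddMonoidHom.mem_ker, map_sub, map_add,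
        FreeAbelianGroup.lift_apply_of]
      refine sub_eq_zero.2 (Units.ext ?_)
      change (u _ : Γ) = u _ * u _
      obtain ⟨n, ι, π, hιπ⟩ := exists_retract S P
      rw [hu ⟨⟨P, g ∘ₗ f⟩, hgf⟩ _ ι π hιπ, hu ⟨⟨P, g⟩, hg⟩ _ ι π hιπ, hu ⟨⟨P, f⟩, hf⟩ _ ι π hιπ]
      change D (Fin n) (retractMatrix ι π (g ∘ₗ f)) = _
      rw [retractMatrix_comp hιπ, hD.mul ((isUnit_retractMatrix_iff hιπ _).2 hf)
        ((isUnit_retractMatrix_iff hιπ _).2 hg), mul_comm]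
    · simp only [SetLike.mem_coe, AddMonoidHom.mem_ker, map_sub, map_add,
        FreeAbelianGroup.lift_apply_of]
      refine sub_eq_zero.2 (Units.ext ?_)
      change (u x₁ : Γ) = u x₀ * u x₂
      obtain ⟨n, ι, π, hιπ⟩ := exists_retract S x₀.1.P
      obtain ⟨n', ι', π', hιπ'⟩ := exists_retract S x₂.1.P
      obtain ⟨j, q, hj, hjq, hq, h₀, h₂⟩ := hx
      obtain ⟨ι₁, π₁, Y, h₁, e⟩ := exists_retractMatrix_eq_fromBlocks hj hjq hq h₀ h₂ hιπ hιπ'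
      rw [hu x₀ _ ι π hιπ, hu x₂ _ ι' π' hιπ', hu x₁ _ ι₁ π₁ h₁, e,
        hD.fromBlocks_lower ((isUnit_retractMatrix_iff hιπ _).2 x₀.2)
          ((isUnit_retractMatrix_iff hιπ' _).2 x₂.2)]
  · intro x hx n _ _ ι π hιπ
    rw [← hu ⟨x, hx⟩ n ι π hιπ]
    exact congrArg (fun a : Additive Γˣ => (a.toMul : Γ)) (FreeAbelianGroup.lift_apply_of _ _)

end LiftDet

/-! ### Fractions over the universal localization -/

section UniversalLocalization

variable {R : Type u} [Ring R] {Sig : Set (FGProjEnd R)} {S : Type u} [Ring S] {i : R →+* S}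

theorem kdet_retractMatrix_ne_zero {P : Type u} [AddCommGroup P] [Module R P] [Module.Finite R P]
    [Module.Projective R P] {n : Type} [Fintype n] [DecidableEq n]
    {ι : P →ₗ[R] (n → R)} {π : (n → R) →ₗ[R] P} (hιπ : ∀ x, π (ι x) = x) {f : P →ₗ[R] P}
    (hf : (⟨P, f⟩ : FGProjEnd R).BecomesAuto i) :
    kdet (FGProjEnd.BecomesAuto i) (retractMatrix ι π f) ≠ 0 := by
  rw [kdet_ne_zero_iff_isUnit (detectsUnits_becomesAuto i)]
  exact (becomesAuto_iff_isUnit_retractMatrix i hιπ f).1 hf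

/-- The universal property applied to R → End(`LocRow`): after completion to a matrix, each σ acts
invertibly on row fractions. Taking natural numbers as sizes in `FormalRow` keeps this ring in `Type
u`, as the universal property requires. -/
theorem IsUniversalLocalization.exists_extendsAction (hi : IsUniversalLocalization Sig i)
    (l : Type) [Fintype l] :
    ∃ g : S →+* AddMonoid.End (LocRow (detectsUnits_becomesAuto i) l),
      ExtendsAction (detectsUnits_becomesAuto i) l g := by
  obtain ⟨g, hg, -⟩ := hi.existsUnique_lift (AddMonoid.End (LocRow (detectsUnits_becomesAuto i) l))
    (Module.toAddMonoidEnd R (LocRow (detectsUnits_becomesAuto i) l)) (by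
      intro σ hσ
      obtain ⟨n, ι, π, hιπ⟩ := exists_retract R σ.P
      refine (becomesAuto_iff_isUnit_retractMatrix _ hιπ σ.hom).2 ?_
      exact LocRow.isUnit_map_toAddMonoidEnd _ _
        (kdet_retractMatrix_ne_zero hιπ (hi.inverting σ hσ)))
  refine ⟨g, fun r x => ?_⟩
  have e := congrArg (fun k => k x) (RingHom.congr_fun hg r)
  exact e

/-- The elements of the localization of the form `c A⁻¹ b`. -/
def fractionSubring (i : R →+* S) : Subring S where
  carrier := {s | Representable (FGProjEnd.BecomesAuto i) i (Matrix.of fun _ _ : Unit => s)}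
  mul_mem' {s t} := by
    rintro ⟨n, C, A, B, hs⟩ ⟨n', C', A', B', ht⟩
    have e : (Matrix.of fun _ _ : Unit => s * t) =
        (Matrix.of fun _ _ : Unit => s) * (Matrix.of fun _ _ : Unit => t) := by
      ext; simp [Matrix.mul_apply]
    change Representable _ _ _
    rw [e]
    exact (hs.mul (detectsUnits_becomesAuto i) ht).representable (detectsUnits_becomesAuto i)
  one_mem' := by
    have e : (Matrix.of fun _ _ : Unit => (1 : S)) = (1 : Matrix Unit Unit R).map i := by
      ext; simp
    change Representable _ _ _
    rw [e]
    exact (represents_map (detectsUnits_becomesAuto i) _).representable (detectsUnits_becomesAuto i)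
  add_mem' {s t} := by
    rintro ⟨n, C, A, B, hs⟩ ⟨n', C', A', B', ht⟩
    have e : (Matrix.of fun _ _ : Unit => s + t) =
        (Matrix.of fun _ _ : Unit => s) + (Matrix.of fun _ _ : Unit => t) := by
      ext; simp
    change Representable _ _ _
    rw [e]
    exact (hs.add (detectsUnits_becomesAuto i) ht).representable (detectsUnits_becomesAuto i)
  zero_mem' := by
    have e : (Matrix.of fun _ _ : Unit => (0 : S)) = (0 : Matrix Unit Unit R).map i := by
      ext; simp
    change Representable _ _ _
    rw [e]
    exact (represents_map (detectsUnits_becomesAuto i) _).representable (detectsUnits_becomesAuto i)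
  neg_mem' {s} := by
    rintro ⟨n, C, A, B, hs⟩
    have e : (Matrix.of fun _ _ : Unit => -s) =
        (-1 : Matrix Unit Unit R).map i * (Matrix.of fun _ _ : Unit => s) := by
      ext; simp [Matrix.mul_apply]
    change Representable _ _ _
    rw [e]
    exact ((represents_map (detectsUnits_becomesAuto i) _).mul (detectsUnits_becomesAuto i)
      hs).representable (detectsUnits_becomesAuto i)

theorem map_mem_fractionSubring (r : R) : i r ∈ fractionSubring i := by
  have e : (Matrix.of fun _ _ : Unit => i r) = (Matrix.of fun _ _ : Unit => r).map i := by
    ext; simp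
  change Representable _ _ _
  rw [e]
  exact (represents_map (detectsUnits_becomesAuto i) _).representable (detectsUnits_becomesAuto i)

theorem inv_apply_mem_fractionSubring {n : Type} [Fintype n] [DecidableEq n] {A : Matrix n n R}
    {Z : Matrix n n S} (hZ : A.map i * Z = 1) (hZ' : Z * A.map i = 1) (a b : n) :
    Z a b ∈ fractionSubring i := by
  have hW := detectsUnits_becomesAuto i
  have hA : kdet (FGProjEnd.BecomesAuto i) A ≠ 0 := by
    rw [kdet_ne_zero_iff_isUnit hW]
    exact isUnit_iff_exists.2 ⟨Z, hZ, hZ'⟩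
  have e : (Matrix.of fun _ _ : Unit => Z a b) = (Matrix.single () a (1 : R)).map i * Z *
      (Matrix.single b () (1 : R)).map i := by
    have h1 : (Matrix.single () a (1 : R)).map i = Matrix.single () a (1 : S) := by
      ext x y; simp [Matrix.single_apply, apply_ite i]
    have h2 : (Matrix.single b () (1 : R)).map i = Matrix.single b () (1 : S) := by
      ext x y; simp [Matrix.single_apply, apply_ite i]
    rw [h1, h2]
    ext x y
    simp
  change Representable _ _ _
  rw [e]
  exact (((represents_map hW _).mul hW (represents_inv hA hZ)).mul hW
    (represents_map hW _)).representable hW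

/-- Fractions contain the image of R and the entries of the inverses, so `i` is still Σ-inverting as
a map into their subring. It therefore factors through the localization, and by uniqueness the
composite with the inclusion is the identity. -/
theorem IsUniversalLocalization.fractionSubring_eq_top (hi : IsUniversalLocalization Sig i) :
    fractionSubring i = ⊤ := by
  let i' : R →+* fractionSubring i := i.codRestrict (fractionSubring i) map_mem_fractionSubring
  have hinv : IsInverting Sig i' := by
    intro σ hσ
    obtain ⟨n, ι, π, hιπ⟩ := exists_retract R σ.P
    refine (becomesAuto_iff_isUnit_retractMatrix _ hιπ σ.hom).2 ?_
    obtain ⟨Z, h1, h2⟩ := isUnit_iff_exists.1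
      ((becomesAuto_iff_isUnit_retractMatrix i hιπ σ.hom).1 (hi.inverting σ hσ))
    let Z' : Matrix (Fin n) (Fin n) (fractionSubring i) :=
      Matrix.of fun a b => ⟨Z a b, inv_apply_mem_fractionSubring h1 h2 a b⟩
    have hinj : Function.Injective
        (fun M : Matrix (Fin n) (Fin n) (fractionSubring i) => M.map (fractionSubring i).subtype) :=
      Matrix.map_injective Subtype.val_injective
    have e1 : Z'.map (fractionSubring i).subtype = Z := rfl
    have e2 : ((retractMatrix ι π σ.hom).map i').map (fractionSubring i).subtype =
        (retractMatrix ι π σ.hom).map i := rfl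
    refine isUnit_iff_exists.2 ⟨Z', hinj ?_, hinj ?_⟩
    · dsimp only
      rw [Matrix.map_mul, e1, e2, h1, Matrix.map_one _ (map_zero _) (map_one _)]
    · dsimp only
      rw [Matrix.map_mul, e1, e2, h2, Matrix.map_one _ (map_zero _) (map_one _)]
  obtain ⟨g, hg, -⟩ := hi.existsUnique_lift _ i' hinv
  have h1 : (fractionSubring i).subtype.comp g = RingHom.id S :=
    (hi.existsUnique_lift S i hi.inverting).unique
      (by rw [RingHom.comp_assoc, hg]; rfl) (RingHom.id_comp i)
  rw [eq_top_iff]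
  intro s _
  have e := RingHom.congr_fun h1 s
  rw [RingHom.id_apply] at e
  rw [← e]
  exact (g s).2

theorem IsUniversalLocalization.representable (hi : IsUniversalLocalization Sig i)
    {l m : Type} [Fintype l] [Fintype m] [DecidableEq l] [DecidableEq m] (V : Matrix m l S) :
    Representable (FGProjEnd.BecomesAuto i) i V := by
  have hW := detectsUnits_becomesAuto i
  have hmap : ∀ {l m : Type} [Fintype l] [Fintype m] [DecidableEq l] [DecidableEq m]
      (D : Matrix m l R), Representable (FGProjEnd.BecomesAuto i) i (D.map i) := fun D =>
    (represents_map hW D).representable hW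
  induction V using Matrix.induction_on' with
  | h_zero =>
    have e : (0 : Matrix m l S) = (0 : Matrix m l R).map i := by ext; simp
    rw [e]
    exact hmap _
  | h_add p q hp hq =>
    obtain ⟨n, C, A, B, hp⟩ := hp
    obtain ⟨n', C', A', B', hq⟩ := hq
    exact (hp.add hW hq).representable hW
  | h_std_basis a b s =>
    have hs : s ∈ fractionSubring i := hi.fractionSubring_eq_top ▸ Subring.mem_top s
    obtain ⟨n, C, A, B, hs⟩ := hs
    have e : Matrix.single a b s = (Matrix.single a () (1 : R)).map i *
        (Matrix.of fun _ _ : Unit => s) * (Matrix.single () b (1 : R)).map i := by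
      have h1 : (Matrix.single a () (1 : R)).map i = Matrix.single a () (1 : S) := by
        ext x y; simp [Matrix.single_apply, apply_ite i]
      have h2 : (Matrix.single () b (1 : R)).map i = Matrix.single () b (1 : S) := by
        ext x y; simp [Matrix.single_apply, apply_ite i]
      have h3 : (Matrix.of fun _ _ : Unit => s) = Matrix.single () () s := by
        ext x y; simp
      rw [h1, h2, h3]
      simp
    rw [e]
    exact (((represents_map hW _).mul hW hs).mul hW (represents_map hW _)).representable hW

end UniversalLocalization

/-! ### The comparison map -/

section Comparison

variable {R : Type u} [Ring R] {Sig : Set (FGProjEnd R)} {S : Type u} [Ring S] {i : R →+* S}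

theorem IsUniversalLocalization.isDetLike_kdetExt (hi : IsUniversalLocalization Sig i) :
    IsDetLike fun (n : Type) [Fintype n] [DecidableEq n] (V : Matrix n n S) =>
      kdetExt hi.representable V where
  ne_zero hA := kdetExt_ne_zero (detectsUnits_becomesAuto i) hi.exists_extendsAction _ hA
  mul hA _ := kdetExt_mul (detectsUnits_becomesAuto i) hi.exists_extendsAction _ hA
  fromBlocks_lower hA _ :=
    kdetExt_fromBlocks_lower (detectsUnits_becomesAuto i) hi.exists_extendsAction _ hA

theorem becomesAuto_id (P : Type u) [AddCommGroup P] [Module R P] [Module.Finite R P]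
    [Module.Projective R P] : (⟨P, LinearMap.id⟩ : FGProjEnd R).BecomesAuto i := by
  change Function.Bijective (BaseChange.map i (LinearMap.id : P →ₗ[R] P))
  rw [BaseChange.map_id]
  exact Function.bijective_id

theorem isAuto_id (P : Type u) [AddCommGroup P] [Module R P] [Module.Finite R P]
    [Module.Projective R P] : (⟨P, LinearMap.id⟩ : FGProjEnd R).IsAuto :=
  Function.bijective_id

/-- Induction on the generators of `K₁`. -/
theorem K1Presented.induction_on {W : FGProjEnd R → Prop} {motive : K1Presented W → Prop}
    (x : K1Presented W) (mk : ∀ y hy, motive (K1Presented.mk y hy)) (zero : motive 0)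
    (add : ∀ x y, motive x → motive y → motive (x + y)) (neg : ∀ x, motive x → motive (-x)) :
    motive x := by
  obtain ⟨a, rfl⟩ := QuotientAddGroup.mk_surjective x
  induction a using FreeAbelianGroup.induction_on with
  | zero => exact zero
  | of y => exact mk y.1 y.2
  | neg y hy => exact neg _ hy
  | add a b ha hb => exact add _ _ ha hb

/-- The homomorphism φ induced by `kdetExt` sends α[f] to the class of the completed matrix of f, by
`kdetExt_map`, and that class is [f] by `kdet_retractMatrix`. -/
theorem IsUniversalLocalization.injective_toK1 (hi : IsUniversalLocalization Sig i) :
    Function.Injective (K1Loc.toK1 i) := by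
  have hW := detectsUnits_becomesAuto i
  obtain ⟨φ, hφ⟩ := hi.isDetLike_kdetExt.exists_hom
  -- Removes the adjoined zero: the units of the group with zero are the group itself.
  let ψ : K1Loc i ≃+ Additive (WithZero (Multiplicative (K1Loc i)))ˣ :=
    (MulEquiv.toAdditive (WithZero.unitsWithZeroEquiv (α := Multiplicative (K1Loc i)))).symm
  have key : φ.comp (K1Loc.toK1 i) = ψ.toAddMonoidHom := by
    ext x
    induction x using K1Presented.induction_on with
    | zero => simp
    | add x y hx hy => simp_all
    | neg x hx => simp_all
    | mk x hx =>
      obtain ⟨n, ι, π, hιπ⟩ := exists_retract R x.P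
      have e := hφ (x.baseChange i) hx (Fin n)
        ((baseChangeRow i (Fin n)).toLinearMap ∘ₗ BaseChange.map i ι)
        (BaseChange.map i π ∘ₗ (baseChangeRow i (Fin n)).symm.toLinearMap)
        (fun v => (congrArg (BaseChange.map i π)
          ((baseChangeRow i (Fin n)).symm_apply_apply _)).trans (map_retract i hιπ v))
      replace e := e.trans (congrArg (fun V => kdetExt hi.representable V)
        (retractMatrix_baseChange i ι π x.hom))
      rw [kdetExt_map hW hi.exists_extendsAction, kdet_retractMatrix becomesAuto_id hιπ hx
        (kdet_ne_zero_iff.1 (kdet_retractMatrix_ne_zero hιπ hx))] at e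
      rw [AddMonoidHom.comp_apply, K1Loc.toK1_mk]
      exact e
  have hinj : Function.Injective (φ.comp (K1Loc.toK1 i)) := by
    rw [key]
    exact ψ.injective
  exact Function.Injective.of_comp (f := φ) hinj

theorem toK1_mk_matEnd {n : Type} [Fintype n] [DecidableEq n] (A : Matrix n n R)
    (hA : (matEnd A).BecomesAuto i) (hA' : (matEnd (A.map i)).IsAuto) :
    K1Loc.toK1 i (K1Presented.mk (matEnd A) hA) = K1Presented.mk (matEnd (A.map i)) hA' := by
  rw [K1Loc.toK1_mk]
  exact K1Presented.mk_eq_of_equiv isAuto_id _ _ (baseChangeRow i n) (baseChangeRow_comp_map i A)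

/-- Complete an automorphism to an invertible matrix V = C A⁻¹ B. The Schur complement factorization
gives [V] = α[(A B; -C 0)] - α[A]. -/
theorem IsUniversalLocalization.surjective_toK1 (hi : IsUniversalLocalization Sig i) :
    Function.Surjective (K1Loc.toK1 i) := by
  have hW := detectsUnits_becomesAuto i
  have hS := detectsUnits_isAuto (R := S)
  have hid : ∀ {n : Type} (A : Matrix n n S), A.map (RingHom.id S) = A := fun A => rfl
  have key : ∀ {n : Type} [Fintype n] [DecidableEq n] (A : Matrix n n R)
      (hA : kdet (FGProjEnd.BecomesAuto i) A ≠ 0), ∃ x : K1Loc i,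
      kdet FGProjEnd.IsAuto (A.map i) = ↑(Multiplicative.ofAdd (K1Loc.toK1 i x)) := by
    intro n _ _ A hA
    have hA' : (matEnd (A.map i)).IsAuto := by
      rw [hS.iff_isUnit, hid]
      exact (kdet_ne_zero_iff_isUnit hW).1 hA
    refine ⟨K1Presented.mk (matEnd A) (kdet_ne_zero_iff.1 hA), ?_⟩
    rw [kdet_of hA', toK1_mk_matEnd]
  rw [← AddMonoidHom.range_eq_top, eq_top_iff]
  intro y _
  induction y using K1Presented.induction_on with
  | zero => exact zero_mem _
  | add x y hx hy => exact add_mem (hx trivial) (hy trivial)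
  | neg x hx => exact neg_mem (hx trivial)
  | mk y hy =>
    obtain ⟨n, ι, π, hιπ⟩ := exists_retract S y.P
    have hV := (isUnit_retractMatrix_iff hιπ y.hom).2 hy
    have hy' := kdet_retractMatrix isAuto_id hιπ hy (bijective_vecMulLinear_iff.2 hV)
    obtain ⟨n', C, A, B, hr⟩ := hi.representable (retractMatrix ι π y.hom)
    have hM := hr.kdet_ne_zero hW hV
    obtain ⟨hA, Z, h1, h2⟩ := hr
    obtain ⟨a, ha⟩ := key A hA
    obtain ⟨b, hb⟩ := key _ hM
    have hA' : kdet FGProjEnd.IsAuto (A.map i) ≠ 0 := by rw [ha]; exact WithZero.coe_ne_zero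
    have e := kdet_mul_of_right_eq_one hS (kdet_fromBlocks_one_left hS Z)
      (A := fromBlocks (A.map i) 0 (-(C.map i)) (retractMatrix ι π y.hom))
    have e' : fromBlocks (A.map i) 0 (-(C.map i)) (retractMatrix ι π y.hom) * fromBlocks 1 Z 0 1 =
        (fromBlocks A B (-C) 0).map i := by
      rw [fromBlocks_multiply, fromBlocks_map]
      simp only [Matrix.mul_one, Matrix.mul_zero, add_zero, Matrix.neg_mul, h1, h2]
      ext (i | i) (j | j) <;> simp
    rw [e', kdet_fromBlocks_lower hS (Or.inl hA'), ha, hb, hy', ← WithZero.coe_mul,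
      ← ofAdd_add] at e
    have e2 : K1Loc.toK1 i b = K1Loc.toK1 i a + K1Presented.mk y hy :=
      Multiplicative.ofAdd.injective (WithZero.coe_injective e)
    exact ⟨b - a, by rw [map_sub, e2, add_sub_cancel_left]⟩

end Comparison

end

/-! ### The main theorem -/

theorem theorem1p2 {R : Type u} [Ring R] (Sig : Set (FGProjEnd R)) {S : Type u} [Ring S]
    (i : R →+* S) (hi : IsUniversalLocalization Sig i) (hinj : Function.Injective i) :
    Function.Bijective (K1Loc.toK1 i) :=
  ⟨hi.injective_toK1, hi.surjective_toK1⟩
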